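/- Let $\delta$ be a locally nilpotent derivation of $\mathbb{C}[x_1,\dots,x_n]$, and let $\mathbb{C}$ act on functions by $t.f=\sum_{j\ge 0}\frac{t^j}{j!}\delta^j f$ and on $\mathbb{C}^n$ correspondingly, i.e. $x_k((-t).x)=\sum_{j\ge0}\frac{t^j}{j!}(\delta^jx_k)(x)$. Assume that this action is free, and let $d$ be its degree, i.e. the smallest number such that $\delta^{d+1}(x_j)=0$ for all $j$. Let $x\in\mathbb{C}^n$ lie on a generic orbit, i.e. $(\delta^d x_j)(x)\neq 0$ for some $j$. Embed $\mathbb{C}^n$ in $\mathbb{P}_n$ by $x\mapsto[1:x_1:\dots:x_n]$ and let $C_x=\overline{\mathbb{C}.x}\subset\mathbb{P}_n$. Put $x_0:=1$ and, in variables $\alpha_0,\dots,\alpha_n,\beta_0,\dots,\beta_n$, $$A_k=\sum_{j=0}^n\alpha_j(\delta^kx_j)(x),\qquad B_k=\sum_{j=0}^n\beta_j(\delta^kx_j)(x),\qquad f_{lk}=B_lA_k-A_lB_k,$$ $$F_{lk}=\sum_{r=0}^{\min(d-l,k)}f_{l+r,k-r}\prod_{j=0}^{d-l-r-1}(d-j)\prod_{j=0}^{r-1}(k-j),\qquad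 P(x)=\det(F_{lk})_{1\le l\le d,\;0\le k\le d-1}.$$ Then $C_x$ is an irreducible projective curve of degree $d$, and its Chow point is the class of $P(x)$. That is, $P(x)$ is a nonzero bihomogeneous polynomial of bidegree $(d,d)$ in $(\alpha,\beta)$, and it is the defining polynomial of $$H_{C_x}=\bigcup_{p\in C_x}\{(\alpha,\beta)\in\mathbb{P}_n\times\mathbb{P}_n \mid p\in H_\alpha\cap H_\beta\},\qquad H_\alpha=\Big\{\sum_{j=0}^n\alpha_jX_j=0\Big\}:$$ the zero set of $P(x)$ in $\mathbb{P}_n\times\mathbb{P}_n$ is $H_{C_x}$, and every polynomial in $(\alpha,\beta)$ vanishing on $H_{C_x}$ (that is, at all pairs of nonzero vectors representing points of $H_{C_x}$) is a multiple of $P(x)$. -/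

import Mathlib

open MvPolynomial

namespace ChowOrbit

noncomputable section

/-! ### Locally nilpotent derivations and their actions of the additive group -/

/-- A derivation of the polynomial ring `ℂ[x₁, …, xₙ]`. -/
abbrev PolyDerivation (n : ℕ) : Type :=
  Derivation ℂ (MvPolynomial (Fin n) ℂ) (MvPolynomial (Fin n) ℂ)

/-- Every polynomial is killed by some power of `δ`. -/
def IsLocallyNilpotent {n : ℕ} (δ : PolyDerivation n) : Prop :=
  ∀ f : MvPolynomial (Fin n) ℂ, ∃ N : ℕ, (⇑δ)^[N] f = 0

/-- The degree of `δ` with respect to the given coordinates is `d`: the number `d` is the smallest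
one such that `δ ^ (d + 1)` kills every coordinate function. -/
def HasDegree {n : ℕ} (δ : PolyDerivation n) (d : ℕ) : Prop :=
  IsLeast {m : ℕ | ∀ j : Fin n, (⇑δ)^[m + 1] (X j) = 0} d

/-- The action on functions, `t.f = ∑ j, t ^ j / j! • δ ^ j f`. The sum is finite when `δ` is
locally nilpotent. -/
def actFun {n : ℕ} (δ : PolyDerivation n) (t : ℂ) (f : MvPolynomial (Fin n) ℂ) :
    MvPolynomial (Fin n) ℂ :=
  ∑ᶠ j : ℕ, (t ^ j / (j.factorial : ℂ)) • (⇑δ)^[j] f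

/-- The corresponding action on points of `ℂⁿ`, normalised by `(t.f)(x) = f((-t).x)`. -/
def actPoint {n : ℕ} (δ : PolyDerivation n) (t : ℂ) (x : Fin n → ℂ) : Fin n → ℂ :=
  fun k => eval x (actFun δ (-t) (X k))

/-- The action defined by `δ` is free: all isotropy groups are trivial. -/
def IsFreeAction {n : ℕ} (δ : PolyDerivation n) : Prop :=
  ∀ (t : ℂ) (x : Fin n → ℂ), actPoint δ t x = x → t = 0

/-- The set `U₀` of points on generic orbits, the union of the sets `{δ ^ d xⱼ ≠ 0}`. -/
def genericSet {n : ℕ} (δ : PolyDerivation n) (d : ℕ) : Set (Fin n → ℂ) :=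
  {x | ∃ j : Fin n, eval x ((⇑δ)^[d] (X j)) ≠ 0}

/-! ### Projective space, curves and their degree -/

/-- Complex projective space of dimension `n`, with homogeneous coordinates `X₀, …, Xₙ`. -/
abbrev ProjSpace (n : ℕ) : Type := Projectivization ℂ (Fin (n + 1) → ℂ)

/-- A polynomial vanishes at every point of `S`. It is used for homogeneous polynomials, where the
choice of homogeneous coordinates does not matter. -/
def VanishesOn {n : ℕ} (f : MvPolynomial (Fin (n + 1)) ℂ) (S : Set (ProjSpace n)) : Prop :=
  ∀ p ∈ S, eval p.rep f = 0

/-- The Zariski closure: the common zeros of all homogeneous polynomials that vanish on `S`. -/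
def zariskiClosure {n : ℕ} (S : Set (ProjSpace n)) : Set (ProjSpace n) :=
  {p | ∀ (m : ℕ) (f : MvPolynomial (Fin (n + 1)) ℂ),
    f.IsHomogeneous m → VanishesOn f S → eval p.rep f = 0}

/-- A nonempty set whose homogeneous vanishing ideal is prime. -/
def IsZariskiIrreducible {n : ℕ} (S : Set (ProjSpace n)) : Prop :=
  S.Nonempty ∧ ∀ (k m : ℕ) (f g : MvPolynomial (Fin (n + 1)) ℂ),
    f.IsHomogeneous k → g.IsHomogeneous m → VanishesOn (f * g) S →
      VanishesOn f S ∨ VanishesOn g S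

/-- The hyperplane `H_a = {a₀ X₀ + ⋯ + aₙ Xₙ = 0}` of a point `a` of the dual space. -/
def hyperplane {n : ℕ} (a : ProjSpace n) : Set (ProjSpace n) :=
  {p | ∑ j, a.rep j * p.rep j = 0}

/-- `C` is an irreducible projective curve of degree `d`: a closed irreducible subset that a general
hyperplane meets in exactly `d` points, `d ≥ 1`. (A closed irreducible set with nonempty finite
general hyperplane sections has dimension one.) -/
def IsCurveOfDegree {n : ℕ} (C : Set (ProjSpace n)) (d : ℕ) : Prop :=
  zariskiClosure C = C ∧ IsZariskiIrreducible C ∧ 0 < d ∧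
    ∃ G : MvPolynomial (Fin (n + 1)) ℂ, G ≠ 0 ∧
      ∀ (a : Fin (n + 1) → ℂ) (ha : a ≠ 0), eval a G ≠ 0 →
        (C ∩ hyperplane (Projectivization.mk ℂ a ha)).ncard = d

/-! ### Chow points -/

/-- The polynomial ring in `α₀, …, αₙ` (left summand) and `β₀, …, βₙ` (right summand). -/
abbrev BiPoly (n : ℕ) : Type := MvPolynomial (Fin (n + 1) ⊕ Fin (n + 1)) ℂ

/-- The space of polynomials that are bihomogeneous of bidegree `(d, d)` in `α` and `β`. -/
def bihomForms (n d : ℕ) : Submodule ℂ (BiPoly n) :=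
  weightedHomogeneousSubmodule ℂ (Sum.elim (fun _ => 1) (fun _ => 0) : _ → ℕ) d ⊓
    weightedHomogeneousSubmodule ℂ (Sum.elim (fun _ => 0) (fun _ => 1) : _ → ℕ) d

/-- The set `H_C` of pairs `(α, β)` such that `H_α ∩ H_β` meets `C`. -/
def chowHypersurface {n : ℕ} (C : Set (ProjSpace n)) : Set (ProjSpace n × ProjSpace n) :=
  ⋃ p ∈ C, {q | p ∈ hyperplane q.1 ∩ hyperplane q.2}

/-- `P` is a defining polynomial of the subset `H` of `ℙₙ × ℙₙ`: its zero set is `H`, and every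
polynomial that vanishes on (the bicone over) `H` is a multiple of `P`. -/
def IsDefiningPolynomial {n : ℕ} (P : BiPoly n) (H : Set (ProjSpace n × ProjSpace n)) : Prop :=
  (∀ (a b : Fin (n + 1) → ℂ) (ha : a ≠ 0) (hb : b ≠ 0),
    eval (Sum.elim a b) P = 0 ↔
      (Projectivization.mk ℂ a ha, Projectivization.mk ℂ b hb) ∈ H) ∧
  ∀ f : BiPoly n,
    (∀ (a b : Fin (n + 1) → ℂ) (ha : a ≠ 0) (hb : b ≠ 0),
      (Projectivization.mk ℂ a ha, Projectivization.mk ℂ b hb) ∈ H →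
        eval (Sum.elim a b) f = 0) →
    P ∣ f

/-- `C` is a curve of degree `d` and `p`, a point of the projective space of bihomogeneous
polynomials of bidegree `(d, d)`, is its Chow point. -/
def IsChowPoint {n d : ℕ} (C : Set (ProjSpace n)) (p : Projectivization ℂ (bihomForms n d)) :
    Prop :=
  IsCurveOfDegree C d ∧ IsDefiningPolynomial (p.rep : BiPoly n) (chowHypersurface C)

/-! ### Closures of orbits and the explicit polynomial -/

/-- The embedding `x ↦ [1 : x₁ : ⋯ : xₙ]` of `ℂⁿ` in projective space. -/
def embed {n : ℕ} (x : Fin n → ℂ) : ProjSpace n :=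
  Projectivization.mk ℂ (Fin.cons 1 x : Fin (n + 1) → ℂ)
    (fun h => one_ne_zero (congrFun h 0))

/-- The closure `C_x` in projective space of the orbit through `x`. -/
def orbitClosure {n : ℕ} (δ : PolyDerivation n) (x : Fin n → ℂ) : Set (ProjSpace n) :=
  zariskiClosure (Set.range fun t : ℂ => embed (actPoint δ t x))

/-- The functions `x₀ = 1, x₁, …, xₙ`. -/
def coord (n : ℕ) : Fin (n + 1) → MvPolynomial (Fin n) ℂ :=
  Fin.cons 1 X

/-- `A_k = ∑ j, α_j (δ ^ k x_j)(x)`. -/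
def formA {n : ℕ} (δ : PolyDerivation n) (x : Fin n → ℂ) (k : ℕ) : BiPoly n :=
  ∑ j : Fin (n + 1), X (Sum.inl j) * C (eval x ((⇑δ)^[k] (coord n j)))

/-- `B_k = ∑ j, β_j (δ ^ k x_j)(x)`. -/
def formB {n : ℕ} (δ : PolyDerivation n) (x : Fin n → ℂ) (k : ℕ) : BiPoly n :=
  ∑ j : Fin (n + 1), X (Sum.inr j) * C (eval x ((⇑δ)^[k] (coord n j)))

/-- `f_{lk} = B_l A_k - A_l B_k`. -/
def formf {n : ℕ} (δ : PolyDerivation n) (x : Fin n → ℂ) (l k : ℕ) : BiPoly n :=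
  formB δ x l * formA δ x k - formA δ x l * formB δ x k

/-- `F_{lk} = ∑_{r=0}^{min(d-l,k)} f_{l+r,k-r} ∏_{j=0}^{d-l-r-1} (d-j) ∏_{j=0}^{r-1} (k-j)`,
for `l, k ≤ d`. -/
def formF {n : ℕ} (δ : PolyDerivation n) (d : ℕ) (x : Fin n → ℂ) (l k : ℕ) : BiPoly n :=
  ∑ r ∈ Finset.range (min (d - l) k + 1),
    formf δ x (l + r) (k - r) *
      (∏ j ∈ Finset.range (d - l - r), ((d : BiPoly n) - (j : BiPoly n))) *
      (∏ j ∈ Finset.range r, ((k : BiPoly n) - (j : BiPoly n)))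

/-- `P(x) = det (F_{lk}(x))`, with rows `l = 1, …, d` and columns `k = 0, …, d - 1`. -/
def chowPoly {n : ℕ} (δ : PolyDerivation n) (d : ℕ) (x : Fin n → ℂ) : BiPoly n :=
  Matrix.det (Matrix.of fun l k : Fin d => formF δ d x ((l : ℕ) + 1) (k : ℕ))

end

end ChowOrbit

namespace ChowOrbit

noncomputable section

/-! ### The Bezout matrix -/

/-! The orbit through `x` is the polynomial curve $t\mapsto q(t)$ with $q_0=1$ and
$q_j(t)=\sum_{k\le d}\frac{t^k}{k!}(\delta^kx_j)(x)$. Freeness makes it injective, and genericity of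
`x` makes its degree exactly `d`, so its closure adds just one point, the vector of coefficients of
$t^d$. The hyperplane $H_\alpha$ cuts this curve in the zeros of $\sum_j\alpha_jq_j(t)$, regarded as
a polynomial of degree `d` on the projective line. Hence $H_\alpha\cap H_\beta$ meets the curve iff
two such polynomials have a common zero, possibly at infinity, and this is detected by their Bezout
determinant (`det_bezoutMatrix_eq_zero_iff`). After the factorials are cleared, $F_{lk}$ is $d!\,k!$
times a Bezout entry, so `P(x)` is a nonzero constant times this determinant
(`chowPoly_eq_smul_bezoutForm`).

The determinant also has to generate the ideal of $H_{C_x}$ (`bezoutForm_dvd`). In $\beta_0$, which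
enters only through the constant term of the second polynomial, it has degree `d` with leading
coefficient $\pm a_d^d$, where $a_d$ is the $t^d$ coefficient of the first. For generic
$\alpha,\beta_1,\dots,\beta_n$ it has `d` distinct zeros in $\beta_0$. The remainder of
pseudo-division by it of any polynomial vanishing on $H_{C_x}$ is therefore zero, and the powers of
the prime $a_d$ cancel because $a_d$ does not divide the determinant. -/

/-- The Bezout matrix of `∑ k ≤ d, a k * t ^ k` and `∑ k ≤ d, b k * t ^ k`, with respect to the
degree bound `d`. -/
def bezoutMatrix {R : Type*} [CommRing R] (d : ℕ) (a b : ℕ → R) : Matrix (Fin d) (Fin d) R :=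
  Matrix.of fun l k => ∑ r ∈ Finset.range (min (d - (l + 1)) k + 1),
    (b (l + 1 + r) * a (k - r) - a (l + 1 + r) * b (k - r))

theorem map_det_bezoutMatrix {R S : Type*} [CommRing R] [CommRing S] (f : R →+* S) (d : ℕ)
    (a b : ℕ → R) :
    f (bezoutMatrix d a b).det = (bezoutMatrix d (fun k => f (a k)) fun k => f (b k)).det := by
  rw [RingHom.map_det]
  congr 1
  ext l k
  simp [bezoutMatrix]

/-- The polynomial obtained by dropping the `l` lowest coefficients and dividing by `X ^ l`. -/
def upperPart {R : Type*} [CommRing R] (l : ℕ) (A : Polynomial R) : Polynomial R :=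
  A /ₘ Polynomial.X ^ l

theorem coeff_upperPart {R : Type*} [CommRing R] [Nontrivial R] (l : ℕ) (A : Polynomial R)
    (r : ℕ) : (upperPart l A).coeff r = A.coeff (l + r) := by
  have h := Polynomial.modByMonic_add_div A (Polynomial.X ^ l)
  have hd := Polynomial.degree_modByMonic_lt A (Polynomial.monic_X_pow (R := R) l)
  rw [Polynomial.degree_X_pow] at hd
  conv_rhs => rw [← h]
  rw [Polynomial.coeff_add, add_comm l r, Polynomial.coeff_X_pow_mul,
    Polynomial.coeff_eq_zero_of_degree_lt (hd.trans_le (by exact_mod_cast Nat.le_add_left l r)),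
    zero_add]
  rfl

theorem natDegree_upperPart_le {R : Type*} [CommRing R] [Nontrivial R] (l d : ℕ)
    {A : Polynomial R} (hA : A.natDegree ≤ d) : (upperPart l A).natDegree ≤ d - l := by
  rw [Polynomial.natDegree_le_iff_coeff_eq_zero]
  intro N hN
  rw [coeff_upperPart]
  exact Polynomial.coeff_eq_zero_of_natDegree_lt (by omega)

/-- Write $A=A_0+X^{l+1}A_1$ and $B=B_0+X^{l+1}B_1$. The products $X^{l+1}A_1B_1$ cancel, leaving
$A_0B_1-B_0A_1$ with factors of degree at most $l$ and $d-l-1$. -/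
theorem natDegree_mul_upperPart_sub_lt {R : Type*} [CommRing R] [Nontrivial R] {l d : ℕ}
    (hl : l + 1 ≤ d) {A B : Polynomial R} (hA : A.natDegree ≤ d) (hB : B.natDegree ≤ d) :
    (A * upperPart (l + 1) B - B * upperPart (l + 1) A).natDegree < d := by
  have hm : (Polynomial.X ^ (l + 1) : Polynomial R).Monic := Polynomial.monic_X_pow _
  have hl0 : (Polynomial.X ^ (l + 1) : Polynomial R) ≠ 1 := fun h => by
    simpa using congrArg Polynomial.natDegree h
  have key : ∀ D : Polynomial R, (D %ₘ Polynomial.X ^ (l + 1)).natDegree ≤ l := fun D => by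
    have := Polynomial.natDegree_modByMonic_lt D hm hl0
    rw [Polynomial.natDegree_X_pow] at this
    omega
  have e : A * upperPart (l + 1) B - B * upperPart (l + 1) A =
      (A %ₘ Polynomial.X ^ (l + 1)) * upperPart (l + 1) B -
        (B %ₘ Polynomial.X ^ (l + 1)) * upperPart (l + 1) A := by
    have h1 := Polynomial.modByMonic_add_div A (Polynomial.X ^ (l + 1))
    have h2 := Polynomial.modByMonic_add_div B (Polynomial.X ^ (l + 1))
    simp only [upperPart]
    linear_combination (-(B /ₘ Polynomial.X ^ (l + 1))) * h1 + (A /ₘ Polynomial.X ^ (l + 1)) * h2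
  have hu : ∀ D E : Polynomial R, E.natDegree ≤ d →
      ((D %ₘ Polynomial.X ^ (l + 1)) * upperPart (l + 1) E).natDegree < d := fun D E hE =>
    (Polynomial.natDegree_mul_le.trans
      (add_le_add (key D) (natDegree_upperPart_le (l + 1) d hE))).trans_lt (by omega)
  rw [e]
  exact (Polynomial.natDegree_sub_le _ _).trans_lt (max_lt (hu A B hB) (hu B A hA))

theorem bezoutMatrix_apply_eq_coeff {R : Type*} [CommRing R] [Nontrivial R] {d : ℕ}
    {A B : Polynomial R} (hA : A.natDegree ≤ d) (hB : B.natDegree ≤ d) (l k : Fin d) :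
    bezoutMatrix d A.coeff B.coeff l k =
      (A * upperPart (l + 1) B - B * upperPart (l + 1) A).coeff k := by
  rw [mul_comm A, mul_comm B, Polynomial.coeff_sub, Polynomial.coeff_mul, Polynomial.coeff_mul,
    Finset.Nat.sum_antidiagonal_eq_sum_range_succ_mk,
    Finset.Nat.sum_antidiagonal_eq_sum_range_succ_mk, ← Finset.sum_sub_distrib]
  simp only [bezoutMatrix, Matrix.of_apply, coeff_upperPart]
  -- The additional terms of the convolution have $l+1+r>d$, where the coefficients vanish.
  refine Finset.sum_subset (Finset.range_subset_range.2 (by omega)) fun r hr hr' => ?_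
  rw [Finset.mem_range] at hr hr'
  rw [Polynomial.coeff_eq_zero_of_natDegree_lt (p := A) (n := (l : ℕ) + 1 + r) (by omega),
    Polynomial.coeff_eq_zero_of_natDegree_lt (p := B) (n := (l : ℕ) + 1 + r) (by omega)]
  simp

/-- Each row is thus a polynomial combination of `A` and `B`: common zeros give right kernel
vectors, and left kernel vectors give syzygies. -/
theorem sum_bezoutMatrix_mul_pow {R : Type*} [CommRing R] [Nontrivial R] {d : ℕ}
    {A B : Polynomial R} (hA : A.natDegree ≤ d) (hB : B.natDegree ≤ d) (l : Fin d) :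
    ∑ k : Fin d, Polynomial.C (bezoutMatrix d A.coeff B.coeff l k) * Polynomial.X ^ (k : ℕ) =
      A * upperPart (l + 1) B - B * upperPart (l + 1) A := by
  simp only [bezoutMatrix_apply_eq_coeff hA hB]
  conv_rhs => rw [Polynomial.as_sum_range_C_mul_X_pow' _
    (natDegree_mul_upperPart_sub_lt (l := l) (by omega) hA hB)]
  rw [Finset.sum_range]

theorem det_bezoutMatrix_swap {R : Type*} [CommRing R] (d : ℕ) (a b : ℕ → R) :
    (bezoutMatrix d b a).det = (-1) ^ d * (bezoutMatrix d a b).det := by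
  have : bezoutMatrix d b a = -bezoutMatrix d a b := by
    ext l k
    simp only [bezoutMatrix, Matrix.of_apply, Matrix.neg_apply, ← Finset.sum_neg_distrib]
    exact Finset.sum_congr rfl fun _ _ => by ring
  rw [this, Matrix.det_neg, Fintype.card_fin]

/-- The `l`-th polynomial has degree exactly $d-l-1$ and the leading coefficient of `A`, so the
system is triangular. -/
theorem upperPart_independent {K : Type*} [Field K] {d : ℕ} {A : Polynomial K}
    (hA : A.natDegree = d) (hA0 : A ≠ 0) (v : Fin d → K)
    (hv : ∑ l : Fin d, Polynomial.C (v l) * upperPart (l + 1) A = 0) : v = 0 := by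
  have hc : A.coeff d ≠ 0 := by rw [← hA]; simpa using hA0
  have key : ∀ m : ℕ, ∀ l : Fin d, (l : ℕ) = m → v l = 0 := by
    intro m
    induction m using Nat.strong_induction_on with
    | _ m ih =>
      intro l hl
      have h := congrArg (fun D => Polynomial.coeff D (d - (l + 1))) hv
      simp only [Polynomial.finsetSum_coeff, Polynomial.coeff_C_mul, coeff_upperPart,
        Polynomial.coeff_zero] at h
      rw [Finset.sum_eq_single l] at h
      · rw [show (l : ℕ) + 1 + (d - (l + 1)) = d by omega] at h
        exact (mul_eq_zero.1 h).resolve_right hc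
      · intro j _ hj
        have hj' : (j : ℕ) ≠ l := fun h => hj (Fin.ext h)
        rcases lt_or_gt_of_ne hj' with hlt | hgt
        · rw [ih j (by omega) j rfl, zero_mul]
        · rw [Polynomial.coeff_eq_zero_of_natDegree_lt (by omega), mul_zero]
      · simp
  exact funext fun l => key l l rfl

/-- A left kernel vector $v$ gives $A\sum v_lB_l=B\sum v_lA_l$, with $A_l$, $B_l$ the upper parts.
By coprimality `A` divides $\sum v_lA_l$, whose degree is below `d`; so this sum is zero, and $v=0$
by independence. -/
theorem det_bezoutMatrix_ne_zero_of_isCoprime {K : Type*} [Field K] {d : ℕ} {A B : Polynomial K}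
    (hA : A.natDegree = d) (hA0 : A ≠ 0) (hB : B.natDegree ≤ d) (h : IsCoprime A B) :
    (bezoutMatrix d A.coeff B.coeff).det ≠ 0 := by
  intro h0
  obtain ⟨v, hv0, hv⟩ := Matrix.exists_vecMul_eq_zero_iff.2 h0
  apply hv0
  have hsum : ∑ l : Fin d, Polynomial.C (v l) *
      (A * upperPart (l + 1) B - B * upperPart (l + 1) A) = 0 := by
    simp only [← sum_bezoutMatrix_mul_pow hA.le hB, Finset.mul_sum]
    rw [Finset.sum_comm]
    refine Finset.sum_eq_zero fun k _ => ?_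
    have := congrFun hv k
    simp only [Matrix.vecMul, dotProduct, Pi.zero_apply] at this
    simp only [← mul_assoc, ← Polynomial.C_mul, ← Finset.sum_mul, ← map_sum, this, map_zero,
      zero_mul]
  have hdvd : A ∣ B * ∑ l : Fin d, Polynomial.C (v l) * upperPart (l + 1) A := by
    refine ⟨∑ l : Fin d, Polynomial.C (v l) * upperPart (l + 1) B, ?_⟩
    rw [← sub_eq_zero, ← neg_eq_zero, neg_sub, Finset.mul_sum, Finset.mul_sum,
      ← Finset.sum_sub_distrib, ← hsum]
    exact Finset.sum_congr rfl fun _ _ => by ring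
  refine upperPart_independent hA hA0 v (by_contra fun hne => ?_)
  have hlt : (∑ l : Fin d, Polynomial.C (v l) * upperPart ((l : ℕ) + 1) A).degree < A.degree := by
    rw [Polynomial.degree_eq_natDegree hA0, hA]
    refine (Polynomial.degree_sum_le _ _).trans_lt
      ((Finset.sup_lt_iff (by simp)).2 fun l _ => ?_)
    refine Polynomial.degree_le_natDegree.trans_lt ?_
    have := (Polynomial.natDegree_C_mul_le (v l) _).trans (natDegree_upperPart_le (l + 1) d hA.le)
    exact_mod_cast (by omega)
  exact absurd (Polynomial.degree_le_of_dvd (h.dvd_of_dvd_mul_left hdvd) hne) (not_le.2 hlt)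

/-- The Bezout determinant detects common zeros on the projective line. -/
theorem det_bezoutMatrix_eq_zero_iff {d : ℕ} (hd : 0 < d) {A B : Polynomial ℂ}
    (hA : A.natDegree ≤ d) (hB : B.natDegree ≤ d) :
    (bezoutMatrix d A.coeff B.coeff).det = 0 ↔
      (A.coeff d = 0 ∧ B.coeff d = 0) ∨ ∃ t, A.eval t = 0 ∧ B.eval t = 0 := by
  constructor
  · intro h0
    by_contra! hcon
    obtain ⟨hinf, hfin⟩ := hcon
    have hcop : IsCoprime A B := by
      rw [Polynomial.isCoprime_iff_aeval_ne_zero_of_isAlgClosed ℂ ℂ]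
      intro t
      simpa [or_iff_not_imp_left] using hfin t
    -- One of the two has exact degree `d`; exchanging them costs only a sign.
    by_cases hAd : A.coeff d = 0
    · have hBd := hinf hAd
      refine det_bezoutMatrix_ne_zero_of_isCoprime
        (hB.antisymm (Polynomial.le_natDegree_of_ne_zero hBd))
        (fun h => hBd (by rw [h, Polynomial.coeff_zero])) hA hcop.symm ?_
      rw [det_bezoutMatrix_swap, h0, mul_zero]
    · exact det_bezoutMatrix_ne_zero_of_isCoprime
        (hA.antisymm (Polynomial.le_natDegree_of_ne_zero hAd))
        (fun h => hAd (by rw [h, Polynomial.coeff_zero])) hB hcop h0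
  · rintro (⟨h1, h2⟩ | ⟨t, h1, h2⟩)
    -- A common zero at infinity kills the last row, whose entries are $b_da_k-a_db_k$.
    · refine Matrix.det_eq_zero_of_row_eq_zero ⟨d - 1, by omega⟩ fun k => ?_
      simp only [bezoutMatrix, Matrix.of_apply]
      rw [show d - (d - 1 + 1) = 0 by omega]
      simp [show d - 1 + 1 = d by omega, h1, h2]
    · refine Matrix.exists_mulVec_eq_zero_iff.1 ⟨fun k : Fin d => t ^ (k : ℕ), fun h => ?_, ?_⟩
      · simpa using congrFun h ⟨0, hd⟩
      · ext l
        have := congrArg (Polynomial.eval t) (sum_bezoutMatrix_mul_pow hA hB l)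
        simpa [Polynomial.eval_finsetSum, h1, h2, Matrix.mulVec, dotProduct] using this

/-- Replacing the lowest coefficient of the second polynomial by an indeterminate gives a polynomial
of degree at most `d`, whose coefficient in degree `d` is, up to sign, `a d ^ d`. -/
theorem natDegree_and_coeff_det_bezoutMatrix {R : Type*} [CommRing R] (d : ℕ) (a b : ℕ → R)
    (c : R) :
    ∃ ε : ℤˣ,
      (bezoutMatrix d (fun k => Polynomial.C (a k)) fun k => if k = 0 then
        Polynomial.C c + Polynomial.X else Polynomial.C (b k)).det.natDegree ≤ d ∧
      (bezoutMatrix d (fun k => Polynomial.C (a k)) fun k => if k = 0 then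
        Polynomial.C c + Polynomial.X else Polynomial.C (b k)).det.coeff d =
          (ε : ℤ) * a d ^ d := by
  -- The lowest coefficient of the second polynomial occurs only in the term $r=k$, where its factor
  -- is $-a_{l+1+k}$. So the indeterminate enters linearly, with a Hankel coefficient matrix.
  set H : Matrix (Fin d) (Fin d) R :=
    Matrix.of fun l k => if (l : ℕ) + 1 + k ≤ d then -a (l + 1 + k) else 0 with hH
  have e : (bezoutMatrix d (fun k => Polynomial.C (a k)) fun k => if k = 0 then
      Polynomial.C c + Polynomial.X else Polynomial.C (b k)) =
      (Polynomial.X : Polynomial R) • H.map Polynomial.C +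
        (bezoutMatrix d a fun k => if k = 0 then c else b k).map Polynomial.C := by
    refine Matrix.ext fun l k => ?_
    simp only [bezoutMatrix, Matrix.of_apply, Matrix.add_apply, Matrix.smul_apply, Matrix.map_apply,
      hH, smul_eq_mul, map_sum]
    by_cases h : (l : ℕ) + 1 + k ≤ d
    · rw [if_pos h, min_eq_right (by omega), Finset.sum_range_succ, Finset.sum_range_succ]
      have h1 : ∀ r ∈ Finset.range (k : ℕ), (k : ℕ) - r ≠ 0 := fun r hr => by
        rw [Finset.mem_range] at hr; omega
      have h2 : ∀ r ∈ Finset.range (k : ℕ),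
          ((if (l : ℕ) + 1 + r = 0 then Polynomial.C c + Polynomial.X
            else Polynomial.C (b (l + 1 + r))) * Polynomial.C (a (k - r)) -
          Polynomial.C (a (l + 1 + r)) * if (k : ℕ) - r = 0 then Polynomial.C c + Polynomial.X
            else Polynomial.C (b (k - r))) =
          Polynomial.C ((if (l : ℕ) + 1 + r = 0 then c else b (l + 1 + r)) * a (k - r) -
            a (l + 1 + r) * if (k : ℕ) - r = 0 then c else b (k - r)) := fun r hr => by
        rw [if_neg (h1 r hr), if_neg (h1 r hr), if_neg (by omega), if_neg (by omega)]
        simp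
      rw [Finset.sum_congr rfl h2]
      simp
      ring
    · rw [if_neg h, map_zero, mul_zero, zero_add]
      refine Finset.sum_congr rfl fun r hr => ?_
      rw [Finset.mem_range] at hr
      rw [if_neg (by omega), if_neg (by omega), if_neg (by omega), if_neg (by omega)]
      simp
  -- Reversing the rows makes the Hankel matrix lower triangular with constant diagonal $-a_d$.
  have hdet : ((Equiv.Perm.sign (Fin.revPerm (n := d)) : ℤ) : R) * H.det = (-a d) ^ d := by
    rw [← Matrix.det_permute, Matrix.det_of_isLowerTriangular]
    · have : ∀ i : Fin d, H.submatrix Fin.revPerm id i i = -a d := fun i => by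
        have h1 : d - ((i : ℕ) + 1) + 1 + i = d := by omega
        simp [hH, h1]
      rw [Finset.prod_congr rfl fun i _ => this i, Finset.prod_const, Finset.card_fin]
    · intro i j hij
      have : (i : ℕ) < j := hij
      simp only [Matrix.submatrix_apply, hH, Matrix.of_apply, Fin.revPerm_apply, Fin.val_rev, id]
      rw [if_neg (by omega)]
  refine ⟨Equiv.Perm.sign (Fin.revPerm (n := d)) * (-1) ^ d, ?_, ?_⟩
  · rw [e]
    simpa using Polynomial.natDegree_det_X_add_C_le H
      (bezoutMatrix d a fun k => if k = 0 then c else b k)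
  · rw [e]
    have h := Polynomial.coeff_det_X_add_C_card H
      (bezoutMatrix d a fun k => if k = 0 then c else b k)
    rw [Fintype.card_fin] at h
    rw [h]
    have hs : ((Equiv.Perm.sign (Fin.revPerm (n := d)) : ℤ) : R) *
        ((Equiv.Perm.sign (Fin.revPerm (n := d)) : ℤ) : R) = 1 := by
      rw [← Int.cast_mul, ← Units.val_mul, Int.units_mul_self]; simp
    rw [neg_pow] at hdet
    push_cast
    linear_combination (-(H.det)) * hs + ((Equiv.Perm.sign (Fin.revPerm (n := d)) : ℤ) : R) * hdet

/-! ### Homogeneous polynomials on projective space -/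

theorem eval_smul_of_isHomogeneous {σ : Type*} {f : MvPolynomial σ ℂ} {m : ℕ}
    (hf : f.IsHomogeneous m) (c : ℂ) (v : σ → ℂ) : eval (c • v) f = c ^ m * eval v f := by
  rw [eval_eq, eval_eq, Finset.mul_sum]
  refine Finset.sum_congr rfl fun e he => ?_
  have h := hf (mem_support_iff.1 he)
  have h' : ∑ i ∈ e.support, e i = m := by
    simpa [Finsupp.weight_apply, Finsupp.sum] using h
  simp only [Pi.smul_apply, smul_eq_mul, mul_pow, Finset.prod_mul_distrib]
  rw [Finset.prod_pow_eq_pow_sum, h']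
  ring

theorem eval_aeval_polynomial {σ : Type*} (q : σ → Polynomial ℂ) (f : MvPolynomial σ ℂ) (t : ℂ) :
    (aeval q f : Polynomial ℂ).eval t = eval (fun j => (q j).eval t) f := by
  rw [← Polynomial.coe_evalRingHom, ← coe_aeval_eq_eval, RingHom.coe_coe, aeval_def,
    hom_eval₂, aeval_def]
  congr 1
  ext x
  simp

theorem eval_rep_mk_eq_zero_iff {n m : ℕ} {f : MvPolynomial (Fin (n + 1)) ℂ}
    (hf : f.IsHomogeneous m) (v : Fin (n + 1) → ℂ) (hv : v ≠ 0) :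
    eval (Projectivization.mk ℂ v hv).rep f = 0 ↔ eval v f = 0 := by
  obtain ⟨c, hc⟩ := Projectivization.exists_smul_eq_mk_rep ℂ v hv
  rw [← hc, Units.smul_def, eval_smul_of_isHomogeneous hf]
  simp

theorem mk_mem_hyperplane_mk {n : ℕ} (a v : Fin (n + 1) → ℂ) (ha : a ≠ 0) (hv : v ≠ 0) :
    Projectivization.mk ℂ v hv ∈ hyperplane (Projectivization.mk ℂ a ha) ↔
      ∑ j, a j * v j = 0 := by
  obtain ⟨c, hc⟩ := Projectivization.exists_smul_eq_mk_rep ℂ v hv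
  obtain ⟨e, he⟩ := Projectivization.exists_smul_eq_mk_rep ℂ a ha
  have : ∑ j, (e • a) j * (c • v) j = (e : ℂ) * c * ∑ j, a j * v j := by
    rw [Finset.mul_sum]
    exact Finset.sum_congr rfl fun j _ => by
      simp only [Units.smul_def, Pi.smul_apply, smul_eq_mul]; ring
  simp only [hyperplane, Set.mem_ofPred_eq, ← hc, ← he]
  rw [this]
  simp

theorem subset_zariskiClosure {n : ℕ} (S : Set (ProjSpace n)) : S ⊆ zariskiClosure S :=
  fun p hp _ _ _ h => h p hp

theorem zariskiClosure_idem {n : ℕ} (S : Set (ProjSpace n)) :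
    zariskiClosure (zariskiClosure S) = zariskiClosure S :=
  Set.Subset.antisymm (fun _ hp m f hf h => hp m f hf fun _ hr => hr m f hf h)
    (subset_zariskiClosure _)

/-- A vector which is not a multiple of `w` is not annihilated by all functionals killing `w`. -/
theorem exists_annihilator_apply_ne_zero {ι : Type*} [Fintype ι] {w p : ι → ℂ}
    (hw : w ≠ 0) (hp : ∀ c : ℂ, c • w ≠ p) :
    ∃ a : ι → ℂ, ∑ j, a j * w j = 0 ∧ ∑ j, a j * p j ≠ 0 := by
  classical
  obtain ⟨i, hi⟩ := Function.ne_iff.1 hw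
  have : ∃ j, w i * p j - w j * p i ≠ 0 := by
    by_contra! h
    refine hp (p i / w i) (funext fun j => ?_)
    have hi' : w i ≠ 0 := hi
    simp only [Pi.smul_apply, smul_eq_mul]
    field_simp
    linear_combination -h j
  obtain ⟨j, hj⟩ := this
  have key : ∀ u : ι → ℂ, ∑ k, (Pi.single j (w i) - Pi.single i (w j) : ι → ℂ) k * u k =
      w i * u j - w j * u i := fun u => by
    simp [sub_mul, Finset.sum_sub_distrib, Pi.single_apply]
  exact ⟨_, by rw [key]; ring, by rwa [key]⟩

/-- The vectors whose pairing with `w` vanishes. -/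
def annihilator {ι : Type*} [Fintype ι] (w : ι → ℂ) : Submodule ℂ (ι → ℂ) :=
  LinearMap.ker (Fintype.linearCombination ℂ w)

theorem mem_annihilator {ι : Type*} [Fintype ι] {w a : ι → ℂ} :
    a ∈ annihilator w ↔ ∑ j, a j * w j = 0 := by
  simp [annihilator, Fintype.linearCombination_apply]

/-- Over an infinite field, finitely many proper subspaces of the annihilator do not cover it. -/
theorem exists_annihilator_forall_ne_zero {ι κ : Type*} [Fintype ι] [Finite κ] {w : ι → ℂ}
    (hw : w ≠ 0) (p : κ → ι → ℂ) (hp : ∀ k, ∀ c : ℂ, c • w ≠ p k) :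
    ∃ a : ι → ℂ, ∑ j, a j * w j = 0 ∧ ∀ k, ∑ j, a j * p k j ≠ 0 := by
  obtain ⟨a, ha, h⟩ := Module.Dual.exists_forall_mem_ne_zero_of_forall_exists (annihilator w)
    (fun k => Fintype.linearCombination ℂ (p k)) fun k => by
      obtain ⟨a, h1, h2⟩ := exists_annihilator_apply_ne_zero hw (hp k)
      exact ⟨a, mem_annihilator.2 h1, by simpa [Fintype.linearCombination_apply] using h2⟩
  exact ⟨a, mem_annihilator.1 ha, fun k => by
    simpa [Fintype.linearCombination_apply] using h k⟩

/-! ### Polynomially parametrised curves -/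

/-- `t ↦ (q j t)_j` is an injective parametrisation, of exact degree `d ≥ 1`, of a curve in the
affine chart where the zeroth coordinate is one. -/
structure IsParametrization {n : ℕ} (d : ℕ) (q : Fin (n + 1) → Polynomial ℂ) : Prop where
  pos : 0 < d
  zero : q 0 = 1
  natDegree_le : ∀ j, (q j).natDegree ≤ d
  exists_coeff_ne_zero : ∃ j, (q j).coeff d ≠ 0
  injective : ∀ s t : ℂ, (∀ j, (q j).eval s = (q j).eval t) → s = t

/-- The linear combination of the coordinate functions with coefficients `a`. -/
def pencil {n : ℕ} (q : Fin (n + 1) → Polynomial ℂ) (a : Fin (n + 1) → ℂ) : Polynomial ℂ :=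
  ∑ j, Polynomial.C (a j) * q j

theorem eval_pencil {n : ℕ} (q : Fin (n + 1) → Polynomial ℂ) (a : Fin (n + 1) → ℂ) (t : ℂ) :
    (pencil q a).eval t = ∑ j, a j * (q j).eval t := by
  simp [pencil, Polynomial.eval_finsetSum]

theorem coeff_pencil {n : ℕ} (q : Fin (n + 1) → Polynomial ℂ) (a : Fin (n + 1) → ℂ) (k : ℕ) :
    (pencil q a).coeff k = ∑ j, a j * (q j).coeff k := by
  simp [pencil, Polynomial.finsetSum_coeff]

/-- The coefficient of `t ^ k` of `∑ j, X (i j) * q j`. -/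
def coeffForm {n : ℕ} {σ : Type*} (q : Fin (n + 1) → Polynomial ℂ) (i : Fin (n + 1) → σ) (k : ℕ) :
    MvPolynomial σ ℂ :=
  ∑ j, X (i j) * C ((q j).coeff k)

theorem eval_coeffForm {n : ℕ} {σ : Type*} (q : Fin (n + 1) → Polynomial ℂ) (i : Fin (n + 1) → σ)
    (v : σ → ℂ) (k : ℕ) : eval v (coeffForm q i k) = (pencil q fun j => v (i j)).coeff k := by
  simp [coeffForm, coeff_pencil]

/-- The Bezout determinant of two general linear combinations of the coordinate functions. -/
def bezoutForm {n : ℕ} (d : ℕ) (q : Fin (n + 1) → Polynomial ℂ) : BiPoly n :=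
  (bezoutMatrix d (coeffForm q Sum.inl) (coeffForm q Sum.inr)).det

theorem eval_bezoutForm {n : ℕ} (d : ℕ) (q : Fin (n + 1) → Polynomial ℂ)
    (a b : Fin (n + 1) → ℂ) : eval (Sum.elim a b) (bezoutForm d q) =
      (bezoutMatrix d (pencil q a).coeff (pencil q b).coeff).det := by
  rw [bezoutForm, map_det_bezoutMatrix]
  simp only [eval_coeffForm, Sum.elim_inl, Sum.elim_inr]

theorem isWeightedHomogeneous_det_bezoutMatrix {σ : Type*} {w : σ → ℕ} (d : ℕ)
    {a b : ℕ → MvPolynomial σ ℂ} {m m' : ℕ} (ha : ∀ k, IsWeightedHomogeneous w (a k) m)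
    (hb : ∀ k, IsWeightedHomogeneous w (b k) m') :
    IsWeightedHomogeneous w (bezoutMatrix d a b).det (d * (m + m')) := by
  rw [Matrix.det_apply']
  refine IsWeightedHomogeneous.sum _ _ _ fun s _ => ?_
  have h := IsWeightedHomogeneous.prod (w := w) Finset.univ
    (fun i => bezoutMatrix d a b (s i) i) (fun _ => m + m') fun i _ => by
      simp only [bezoutMatrix, Matrix.of_apply]
      refine IsWeightedHomogeneous.sum _ _ _ fun r _ => ?_
      refine IsWeightedHomogeneous.sub ?_ ((ha _).mul (hb _))
      rw [add_comm m]
      exact (hb _).mul (ha _)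
  rw [Finset.sum_const, Finset.card_univ, Fintype.card_fin, smul_eq_mul] at h
  have := h.C_mul (((Equiv.Perm.sign s : ℤ) : ℂ))
  simpa using this

theorem isWeightedHomogeneous_coeffForm {n : ℕ} {σ : Type*} (w : σ → ℕ)
    (q : Fin (n + 1) → Polynomial ℂ) (i : Fin (n + 1) → σ) (m : ℕ) (hi : ∀ j, w (i j) = m)
    (k : ℕ) : IsWeightedHomogeneous w (coeffForm q i k) m := by
  refine IsWeightedHomogeneous.sum _ _ _ fun j _ => ?_
  rw [mul_comm, ← hi j]
  exact (isWeightedHomogeneous_X ℂ w (i j)).C_mul _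

theorem bezoutForm_mem_bihomForms {n : ℕ} (d : ℕ) (q : Fin (n + 1) → Polynomial ℂ) :
    bezoutForm d q ∈ bihomForms n d := by
  refine Submodule.mem_inf.2 ⟨?_, ?_⟩ <;> rw [mem_weightedHomogeneousSubmodule, bezoutForm]
  · simpa using isWeightedHomogeneous_det_bezoutMatrix d
      (isWeightedHomogeneous_coeffForm (Sum.elim (fun _ => 1) (fun _ => 0)) q Sum.inl 1
        fun _ => rfl)
      (isWeightedHomogeneous_coeffForm (Sum.elim (fun _ => 1) (fun _ => 0)) q Sum.inr 0
        fun _ => rfl)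
  · simpa using isWeightedHomogeneous_det_bezoutMatrix d
      (isWeightedHomogeneous_coeffForm (Sum.elim (fun _ => 0) (fun _ => 1)) q Sum.inl 0
        fun _ => rfl)
      (isWeightedHomogeneous_coeffForm (Sum.elim (fun _ => 0) (fun _ => 1)) q Sum.inr 1
        fun _ => rfl)

namespace IsParametrization

variable {n d : ℕ} {q : Fin (n + 1) → Polynomial ℂ} (h : IsParametrization d q)

include h

theorem eval_ne_zero (t : ℂ) : (fun j => (q j).eval t) ≠ 0 := fun h0 => by
  simpa [h.zero] using congrFun h0 0

theorem coeff_ne_zero : (fun j => (q j).coeff d) ≠ 0 := fun h0 => by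
  obtain ⟨j, hj⟩ := h.exists_coeff_ne_zero
  exact hj (congrFun h0 j)

/-- The point with parameter `t`. -/
def point (t : ℂ) : ProjSpace n := Projectivization.mk ℂ _ (h.eval_ne_zero t)

/-- The point at infinity of the curve. -/
def infPoint : ProjSpace n := Projectivization.mk ℂ _ h.coeff_ne_zero

/-- The projective closure of the parametrised curve. -/
def curve : Set (ProjSpace n) := zariskiClosure (Set.range h.point)

theorem natDegree_pencil_le (a : Fin (n + 1) → ℂ) : (pencil q a).natDegree ≤ d :=
  Polynomial.natDegree_sum_le_of_forall_le _ _ fun j _ =>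
    (Polynomial.natDegree_C_mul_le _ _).trans (h.natDegree_le j)

theorem eval_bezoutForm_eq_zero_iff (a b : Fin (n + 1) → ℂ) :
    eval (Sum.elim a b) (bezoutForm d q) = 0 ↔
      ((pencil q a).coeff d = 0 ∧ (pencil q b).coeff d = 0) ∨
        ∃ t, (pencil q a).eval t = 0 ∧ (pencil q b).eval t = 0 := by
  rw [eval_bezoutForm, det_bezoutMatrix_eq_zero_iff h.pos (h.natDegree_pencil_le a)
    (h.natDegree_pencil_le b)]

theorem point_injective : Function.Injective h.point := fun s t hst => by
  obtain ⟨c, hc⟩ := (Projectivization.mk_eq_mk_iff' ℂ _ _ _ _).1 hst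
  have h1 : c = 1 := by simpa [h.zero] using congrFun hc 0
  exact (h.injective t s fun j => by simpa [h1] using congrFun hc j).symm

theorem eval_point_eq_zero {m : ℕ} {f : MvPolynomial (Fin (n + 1)) ℂ} (hf : f.IsHomogeneous m)
    (hv : VanishesOn f (Set.range h.point)) (t : ℂ) : eval (fun j => (q j).eval t) f = 0 :=
  (eval_rep_mk_eq_zero_iff hf _ (h.eval_ne_zero t)).1 (hv _ ⟨t, rfl⟩)

/-- In the parameter $s=1/t$ the curve is $s\mapsto s^dq(1/s)$, which extends to $s=0$ with value
the vector of coefficients of $t^d$. A form vanishing for all $s\ne0$ vanishes there too. -/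
theorem infPoint_mem_curve : h.infPoint ∈ h.curve := by
  intro m f hf hv
  refine (eval_rep_mk_eq_zero_iff hf _ h.coeff_ne_zero).2 ?_
  have hzero : (aeval (fun j => (q j).reflect d) f : Polynomial ℂ) = 0 := by
    refine Polynomial.eq_zero_of_infinite_isRoot _
      (Set.Infinite.mono ?_ (Set.finite_singleton (0 : ℂ)).infinite_compl)
    intro s hs
    have hs0 : s ≠ 0 := hs
    have hs1 : s⁻¹ ≠ 0 := inv_ne_zero hs0
    rw [Set.mem_ofPred_eq, Polynomial.IsRoot, eval_aeval_polynomial]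
    have h1 := h.eval_point_eq_zero hf hv s⁻¹
    have h2 : (fun j => (q j).eval s⁻¹) =
        (s⁻¹ ^ d) • fun j => ((q j).reflect d).eval s := funext fun j => by
      let := invertibleOfNonzero hs1
      have := Polynomial.eval₂_reflect_mul_pow (RingHom.id ℂ) s⁻¹ d (q j) (h.natDegree_le j)
      rw [invOf_eq_inv, inv_inv] at this
      simp only [Pi.smul_apply, smul_eq_mul, Polynomial.eval]
      rw [← this, mul_comm]
    rw [h2, eval_smul_of_isHomogeneous hf] at h1
    exact (mul_eq_zero.1 h1).resolve_left (pow_ne_zero _ (pow_ne_zero _ hs1))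
  have := eval_aeval_polynomial (fun j => (q j).reflect d) f 0
  rw [hzero, Polynomial.eval_zero] at this
  rw [this]
  congr 2
  ext j
  rw [← Polynomial.coeff_zero_eq_eval_zero, Polynomial.coeff_reflect, Polynomial.revAt_le d.zero_le,
    Nat.sub_zero]

/-- Choose a hyperplane through `w` missing the point at infinity. It meets the curve in finitely
many points, and a second hyperplane through `w` avoids them all. -/
theorem exists_eval_bezoutForm_ne_zero {w : Fin (n + 1) → ℂ} (hw : w ≠ 0)
    (hpt : ∀ t, Projectivization.mk ℂ w hw ≠ h.point t)
    (hinf : Projectivization.mk ℂ w hw ≠ h.infPoint) :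
    ∃ a b : Fin (n + 1) → ℂ, ∑ j, a j * w j = 0 ∧ ∑ j, b j * w j = 0 ∧
      eval (Sum.elim a b) (bezoutForm d q) ≠ 0 := by
  obtain ⟨a, haw, ha⟩ := exists_annihilator_apply_ne_zero hw (p := fun j => (q j).coeff d)
    fun c hc => hinf ((Projectivization.mk_eq_mk_iff' ℂ _ _ _ _).2 ⟨c, hc⟩).symm
  rw [← coeff_pencil] at ha
  have ha0 : pencil q a ≠ 0 := fun h0 => ha (by rw [h0, Polynomial.coeff_zero])
  obtain ⟨b, hbw, hb⟩ := exists_annihilator_forall_ne_zero hw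
    (fun (t : (pencil q a).roots.toFinset) j => (q j).eval (t : ℂ))
    fun t c hc => hpt t ((Projectivization.mk_eq_mk_iff' ℂ _ _ _ _).2 ⟨c, hc⟩).symm
  refine ⟨a, b, haw, hbw, fun h0 => ?_⟩
  rcases (h.eval_bezoutForm_eq_zero_iff a b).1 h0 with ⟨h1, -⟩ | ⟨t, h1, h2⟩
  · exact ha h1
  · rw [eval_pencil] at h2
    exact hb ⟨t, by simpa [ha0] using h1⟩ h2

/-- The curve consists of the parametrised points and one point at infinity. -/
theorem curve_eq : h.curve = insert h.infPoint (Set.range h.point) := by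
  refine Set.Subset.antisymm (fun p hp => ?_)
    (Set.insert_subset h.infPoint_mem_curve (subset_zariskiClosure _))
  by_contra hnot
  rw [Set.mem_insert_iff, not_or, Set.mem_range, not_exists] at hnot
  induction p using Projectivization.ind with | h w hw => ?_
  obtain ⟨a, b, haw, hbw, hne⟩ := h.exists_eval_bezoutForm_ne_zero hw
    (fun t ht => hnot.2 t ht.symm) hnot.1
  obtain ⟨i, hi⟩ := Function.ne_iff.1 hw
  have hi' : w i ≠ 0 := hi
  -- At a point $v$, `sub u` is $(v_iu-(u\cdot v)e_i)/w_i$: linear in $v$, always orthogonal to $v$,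
  -- and equal to $u$ at $v=w$ if $u\cdot w=0$. Substituting it into the Bezout form gives a form in
  -- the coordinates of $v$ that vanishes on the curve but not at `w`.
  let sub (u : Fin (n + 1) → ℂ) (j : Fin (n + 1)) : MvPolynomial (Fin (n + 1)) ℂ :=
    C (u j) * (C (w i)⁻¹ * X i) - C (if j = i then (w i)⁻¹ else 0) * ∑ k, C (u k) * X k
  have hsub : ∀ u j, (sub u j).IsHomogeneous 1 := fun u j =>
    (((isHomogeneous_X ℂ i).C_mul _).C_mul _).sub
      ((IsHomogeneous.sum _ _ _ fun k _ => (isHomogeneous_X ℂ k).C_mul _).C_mul _)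
  have heval : ∀ u v j, eval v (sub u j) = u j * ((w i)⁻¹ * v i) -
      (if j = i then (w i)⁻¹ else 0) * ∑ k, u k * v k := fun u v j => by
    simp [sub]
  let f : MvPolynomial (Fin (n + 1)) ℂ :=
    (bezoutMatrix d (fun k => ∑ j, sub a j * C ((q j).coeff k))
      fun k => ∑ j, sub b j * C ((q j).coeff k)).det
  have hfh : f.IsHomogeneous (d * (1 + 1)) := by
    refine isWeightedHomogeneous_det_bezoutMatrix d (fun k => ?_) fun k => ?_ <;>
    · refine IsWeightedHomogeneous.sum _ _ _ fun j _ => ?_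
      rw [mul_comm]
      exact (hsub _ j).C_mul _
  have hfe : ∀ v, eval v f = eval (Sum.elim (fun j => eval v (sub a j)) fun j => eval v (sub b j))
      (bezoutForm d q) := fun v => by
    rw [eval_bezoutForm, map_det_bezoutMatrix]
    congr 2 <;>
    · ext k
      simp [coeff_pencil]
  refine hne ?_
  have hw1 : ∀ u : Fin (n + 1) → ℂ, ∑ j, u j * w j = 0 → (fun j => eval w (sub u j)) = u :=
    fun u hu => funext fun j => by rw [heval, hu, inv_mul_cancel₀ hi']; ring
  rw [← hw1 a haw, ← hw1 b hbw, ← hfe, ← eval_rep_mk_eq_zero_iff hfh w hw]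
  refine hp _ f hfh ?_
  rintro _ ⟨t, rfl⟩
  refine (eval_rep_mk_eq_zero_iff hfh _ (h.eval_ne_zero t)).2 ?_
  rw [hfe, h.eval_bezoutForm_eq_zero_iff]
  have hz : ∀ u, ∑ j, eval (fun j => (q j).eval t) (sub u j) * (q j).eval t = 0 := fun u => by
    simp only [heval, sub_mul, Finset.sum_sub_distrib, ite_mul, zero_mul, Finset.sum_ite_eq',
      Finset.mem_univ, if_true]
    rw [Finset.mul_sum, Finset.sum_mul, ← Finset.sum_sub_distrib]
    exact Finset.sum_eq_zero fun j _ => by ring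
  exact Or.inr ⟨t, by rw [eval_pencil, hz], by rw [eval_pencil, hz]⟩

/-- A form vanishes on the curve iff substituting `q` gives zero in the domain $\mathbb{C}[t]$. -/
theorem isZariskiIrreducible_curve : IsZariskiIrreducible h.curve := by
  refine ⟨⟨_, h.infPoint_mem_curve⟩, fun k m f g hf hg hfg => ?_⟩
  have h0 : (aeval q f : Polynomial ℂ) * aeval q g = 0 := by
    rw [← map_mul]
    refine Polynomial.funext fun t => ?_
    rw [eval_aeval_polynomial, Polynomial.eval_zero]
    exact h.eval_point_eq_zero (hf.mul hg) (fun p hp => hfg p (subset_zariskiClosure _ hp)) t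
  have conc : ∀ (k : ℕ) (f : MvPolynomial (Fin (n + 1)) ℂ), f.IsHomogeneous k →
      (aeval q f : Polynomial ℂ) = 0 → VanishesOn f h.curve := fun k f hf hz p hp => by
    refine hp k f hf ?_
    rintro _ ⟨t, rfl⟩
    refine (eval_rep_mk_eq_zero_iff hf _ (h.eval_ne_zero t)).2 ?_
    rw [← eval_aeval_polynomial, hz, Polynomial.eval_zero]
  exact (mul_eq_zero.1 h0).imp (conc k f hf) (conc m g hg)

/-- The form whose nonvanishing means that a hyperplane is transversal to the curve and misses the
point at infinity. -/
theorem exists_transversalForm : ∃ G : MvPolynomial (Fin (n + 1)) ℂ, G ≠ 0 ∧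
    ∀ a, eval a G ≠ 0 → (pencil q a).coeff d ≠ 0 ∧ (pencil q a).Separable := by
  -- The leading coefficient times the Bezout determinant of the pencil and its derivative,
  -- essentially a discriminant. The first factor excludes the common zero at infinity that the
  -- degree bound `d` would allow.
  let G : MvPolynomial (Fin (n + 1)) ℂ := coeffForm q id d *
    (bezoutMatrix d (coeffForm q id) fun k => coeffForm q id (k + 1) * C ((k : ℂ) + 1)).det
  have hder : ∀ a, (Polynomial.derivative (pencil q a)).natDegree ≤ d := fun a =>
    (Polynomial.natDegree_derivative_le _).trans
      ((Nat.sub_le _ _).trans (h.natDegree_pencil_le a))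
  have hG : ∀ a, eval a G = (pencil q a).coeff d *
      (bezoutMatrix d (pencil q a).coeff (Polynomial.derivative (pencil q a)).coeff).det := by
    intro a
    rw [map_mul, map_det_bezoutMatrix, eval_coeffForm]
    congr 3 <;> ext k
    · exact eval_coeffForm q id a k
    · rw [Polynomial.coeff_derivative, map_mul, eval_coeffForm, eval_C]
      rfl
  have hG0 : ∀ a, eval a G ≠ 0 ↔ (pencil q a).coeff d ≠ 0 ∧ ∀ t, (pencil q a).eval t = 0 →
      (Polynomial.derivative (pencil q a)).eval t ≠ 0 := by
    intro a
    rw [hG, mul_ne_zero_iff]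
    refine (and_congr_right' (not_congr (det_bezoutMatrix_eq_zero_iff h.pos
      (h.natDegree_pencil_le a) (hder a)))).trans ?_
    push Not
    exact ⟨fun hh => ⟨hh.1, hh.2.2⟩, fun hh => ⟨hh.1, fun h1 => absurd h1 hh.1, hh.2⟩⟩
  refine ⟨G, fun h0 => ?_, fun a ha => ?_⟩
  · obtain ⟨j, hj⟩ := h.exists_coeff_ne_zero
    have hQ : Polynomial.derivative (q j) ≠ 0 := fun hz => by
      have := congrArg (fun p => Polynomial.coeff p (d - 1)) hz
      simp only [Polynomial.coeff_derivative, Polynomial.coeff_zero, Nat.sub_add_cancel h.pos] at this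
      exact (mul_ne_zero hj (by exact_mod_cast Nat.succ_ne_zero (d - 1))) this
    -- With $-c$ not a critical value of $q_j$, the polynomial $q_j+c$ has only simple zeros, so `G`
    -- is not identically zero.
    obtain ⟨c, hc⟩ := Infinite.exists_notMem_finset
      ((Polynomial.derivative (q j)).roots.toFinset.image fun t => -(q j).eval t)
    have hp : pencil q (Pi.single j 1 + Pi.single 0 c) = q j + Polynomial.C c := by
      simp only [pencil, Pi.add_apply, Polynomial.C_add, add_mul, Finset.sum_add_distrib]
      rw [Finset.sum_eq_single j (by intro k _ hk; simp [hk]) (by simp),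
        Finset.sum_eq_single 0 (by intro k _ hk; simp [hk]) (by simp)]
      simp [h.zero]
    refine (hG0 (Pi.single j 1 + Pi.single 0 c)).2 ⟨?_, fun t ht ht' => hc ?_⟩ (by rw [h0, map_zero])
    · rw [hp, Polynomial.coeff_add, Polynomial.coeff_C_of_ne_zero h.pos.ne', add_zero]
      exact hj
    · rw [hp] at ht ht'
      simp only [Polynomial.eval_add, Polynomial.eval_C, Polynomial.derivative_add,
        Polynomial.derivative_C, add_zero] at ht ht'
      rw [Finset.mem_image]
      exact ⟨t, by simpa [hQ] using ht', by linear_combination -ht⟩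
  · obtain ⟨h1, h2⟩ := (hG0 a).1 ha
    refine ⟨h1, ?_⟩
    rw [Polynomial.Separable, Polynomial.isCoprime_iff_aeval_ne_zero_of_isAlgClosed ℂ ℂ]
    intro t
    simpa [or_iff_not_imp_left] using h2 t

omit h in
theorem card_roots_toFinset {A : Polynomial ℂ} (hA : A.natDegree ≤ d) (hd : A.coeff d ≠ 0)
    (hs : A.Separable) : A.roots.toFinset.card = d := by
  rw [Multiset.toFinset_card_of_nodup (Polynomial.nodup_roots hs),
    IsAlgClosed.card_roots_eq_natDegree]
  exact hA.antisymm (Polynomial.le_natDegree_of_ne_zero hd)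

theorem point_mem_hyperplane (t : ℂ) (a : Fin (n + 1) → ℂ) (ha : a ≠ 0) :
    h.point t ∈ hyperplane (Projectivization.mk ℂ a ha) ↔ (pencil q a).eval t = 0 := by
  rw [point, mk_mem_hyperplane_mk, eval_pencil]

theorem infPoint_mem_hyperplane (a : Fin (n + 1) → ℂ) (ha : a ≠ 0) :
    h.infPoint ∈ hyperplane (Projectivization.mk ℂ a ha) ↔ (pencil q a).coeff d = 0 := by
  rw [infPoint, mk_mem_hyperplane_mk, coeff_pencil]

theorem isCurveOfDegree_curve : IsCurveOfDegree h.curve d := by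
  obtain ⟨G, hG, hG'⟩ := h.exists_transversalForm
  refine ⟨zariskiClosure_idem _, h.isZariskiIrreducible_curve, h.pos, G, hG, fun a ha haG => ?_⟩
  obtain ⟨h1, h2⟩ := hG' a haG
  have hA0 : pencil q a ≠ 0 := fun h0 => h1 (by rw [h0, Polynomial.coeff_zero])
  have : h.curve ∩ hyperplane (Projectivization.mk ℂ a ha) =
      h.point '' ((pencil q a).roots.toFinset : Set ℂ) := by
    ext p
    rw [h.curve_eq]
    constructor
    · rintro ⟨rfl | ⟨t, rfl⟩, hp⟩
      · exact absurd ((h.infPoint_mem_hyperplane a ha).1 hp) h1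
      · exact ⟨t, by simpa [hA0] using (h.point_mem_hyperplane t a ha).1 hp, rfl⟩
    · rintro ⟨t, ht, rfl⟩
      exact ⟨Or.inr ⟨t, rfl⟩, (h.point_mem_hyperplane t a ha).2 (by simpa [hA0] using ht)⟩
  rw [this, Set.ncard_image_of_injective _ h.point_injective, Set.ncard_coe_finset,
    card_roots_toFinset (h.natDegree_pencil_le a) h1 h2]

theorem eval_bezoutForm_eq_zero_iff_mem (a b : Fin (n + 1) → ℂ) (ha : a ≠ 0) (hb : b ≠ 0) :
    eval (Sum.elim a b) (bezoutForm d q) = 0 ↔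
      (Projectivization.mk ℂ a ha, Projectivization.mk ℂ b hb) ∈ chowHypersurface h.curve := by
  rw [h.eval_bezoutForm_eq_zero_iff, chowHypersurface, h.curve_eq]
  simp only [Set.mem_iUnion, Set.mem_ofPred_eq, Set.mem_inter_iff, exists_prop,
    Set.exists_mem_insert, Set.exists_range_iff, h.point_mem_hyperplane,
    h.infPoint_mem_hyperplane]

end IsParametrization

/-! ### Divisibility by the Bezout form -/

/-- Division with remainder by a polynomial that need not be monic, after multiplication by a power
of its coefficient in degree `d`. -/
theorem exists_pow_mul_eq_mul_add {R : Type*} [CommRing R] {d : ℕ} {P : Polynomial R}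
    (hP : P.natDegree ≤ d) (f : Polynomial R) : ∃ (N : ℕ) (g r : Polynomial R),
      Polynomial.C (P.coeff d) ^ N * f = P * g + r ∧ r.degree < d := by
  have key : ∀ (m : ℕ) (f : Polynomial R), f.degree < (d + m : ℕ) →
      ∃ (N : ℕ) (g r : Polynomial R),
        Polynomial.C (P.coeff d) ^ N * f = P * g + r ∧ r.degree < d := by
    intro m
    induction m with
    | zero => exact fun f hf => ⟨0, 0, f, by simp, hf⟩
    | succ m ih =>
      intro f hf
      -- The terms in degree $d+m$ cancel, as in ordinary long division.
      obtain ⟨N, g, r, h, hr⟩ := ih (Polynomial.C (P.coeff d) * f -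
          P * (Polynomial.C (f.coeff (d + m)) * Polynomial.X ^ m)) (by
        rw [Polynomial.degree_lt_iff_coeff_zero] at hf ⊢
        intro k hk
        obtain ⟨e, rfl⟩ := Nat.exists_eq_add_of_le hk
        rw [← mul_assoc, show d + m + e = d + e + m by omega, Polynomial.coeff_sub,
          Polynomial.coeff_mul_X_pow, Polynomial.coeff_C_mul, Polynomial.coeff_mul_C]
        rcases Nat.eq_zero_or_pos e with rfl | he
        · rw [add_zero, mul_comm, sub_self]
        · rw [hf _ (by omega), Polynomial.coeff_eq_zero_of_natDegree_lt (p := P) (n := d + e) (by omega)]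
          ring)
      refine ⟨N + 1, g + Polynomial.C (P.coeff d) ^ N *
        (Polynomial.C (f.coeff (d + m)) * Polynomial.X ^ m), r, ?_, hr⟩
      linear_combination h
  refine key (f.natDegree + 1) f (Polynomial.degree_le_natDegree.trans_lt ?_)
  exact_mod_cast (by omega)

/-- Regard a polynomial as a polynomial in the variable `i`, keeping the ring of coefficients. -/
def univariateAt {σ : Type*} [DecidableEq σ] (i : σ) :
    MvPolynomial σ ℂ →ₐ[ℂ] Polynomial (MvPolynomial σ ℂ) :=
  aeval fun j => if j = i then Polynomial.X else Polynomial.C (X j)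

theorem eval_univariateAt {σ : Type*} [DecidableEq σ] (i : σ) (f : MvPolynomial σ ℂ) :
    (univariateAt i f).eval (X i) = f := by
  have : ((Polynomial.evalRingHom (X i : MvPolynomial σ ℂ)).comp
      (univariateAt i : MvPolynomial σ ℂ →+* _)) = RingHom.id _ := by
    refine MvPolynomial.ringHom_ext (fun c => ?_) fun j => ?_
    · simp [univariateAt, Polynomial.algebraMap_apply]
    · by_cases hj : j = i <;> simp [univariateAt, hj]
  exact congrArg (fun φ => φ f) this

theorem eval₂_univariateAt {σ : Type*} [DecidableEq σ] (i : σ) (f : MvPolynomial σ ℂ)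
    (v : σ → ℂ) (z : ℂ) :
    (univariateAt i f).eval₂ (eval v) z = eval (Function.update v i z) f := by
  have : ((Polynomial.eval₂RingHom (eval v) z).comp
      (univariateAt i : MvPolynomial σ ℂ →+* _)) = eval (Function.update v i z) := by
    refine MvPolynomial.ringHom_ext (fun c => ?_) fun j => ?_
    · simp [univariateAt, Polynomial.algebraMap_apply]
    · by_cases hj : j = i
      · subst hj; simp [univariateAt]
      · simp [univariateAt, hj]
  exact congrArg (fun φ => φ f) this

theorem coeffForm_eq_zero_add {n : ℕ} {σ : Type*} (q : Fin (n + 1) → Polynomial ℂ)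
    (i : Fin (n + 1) → σ) (k : ℕ) : coeffForm q i k =
      X (i 0) * C ((q 0).coeff k) + ∑ j : Fin n, X (i j.succ) * C ((q j.succ).coeff k) :=
  Fin.sum_univ_succ _

theorem univariateAt_mul_C {σ : Type*} [DecidableEq σ] {i j : σ} (hij : j ≠ i) (c : ℂ) :
    univariateAt i (X j * C c) = Polynomial.C (X j * C c) := by
  simp [univariateAt, hij, Polynomial.algebraMap_apply]

/-- Density is used first in `b` for fixed generic `a`, then in `a`. The exceptional set for `b` may
depend on `a`, as it will when it is defined by the roots of `pencil q a`. -/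
theorem eq_zero_of_generic_eval_eq_zero {n : ℕ} {G : MvPolynomial (Fin (n + 1)) ℂ} (hG : G ≠ 0)
    {f : BiPoly n} (h : ∀ a, eval a G ≠ 0 → ∃ D : MvPolynomial (Fin (n + 1)) ℂ, D ≠ 0 ∧
      ∀ b, eval b D ≠ 0 → eval (Sum.elim a b) f = 0) : f = 0 := by
  have h1 : ∀ a, eval a G ≠ 0 → ∀ b, eval (Sum.elim a b) f = 0 := by
    intro a ha b
    obtain ⟨D, hD, hDf⟩ := h a ha
    let g : MvPolynomial (Fin (n + 1)) ℂ := aeval (Sum.elim (fun j => C (a j)) X) f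
    have hg : ∀ b, eval b g = eval (Sum.elim a b) f := fun b => by
      rw [← coe_aeval_eq_eval, RingHom.coe_coe, ← AlgHom.comp_apply, comp_aeval,
        ← coe_aeval_eq_eval, RingHom.coe_coe]
      congr 2
      ext j
      rcases j with j | j <;> simp
    have : D * g = 0 := MvPolynomial.funext fun b => by
      rw [map_mul, map_zero, hg]
      by_cases hb : eval b D = 0
      · rw [hb, zero_mul]
      · rw [hDf b hb, mul_zero]
    rw [← hg, (mul_eq_zero.1 this).resolve_left hD, map_zero]
  have h2 : rename Sum.inl G * f = 0 := MvPolynomial.funext fun v => by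
    rw [map_mul, map_zero, eval_rename]
    by_cases hv : eval (v ∘ Sum.inl) G = 0
    · rw [hv, zero_mul]
    · have := h1 _ hv (v ∘ Sum.inr)
      rw [Sum.elim_comp_inl_inr] at this
      rw [this, mul_zero]
  exact (mul_eq_zero.1 h2).resolve_left fun h0 =>
    hG (rename_injective _ Sum.inl_injective (by rw [h0, map_zero]))

theorem prime_coeffForm {n k : ℕ} {q : Fin (n + 1) → Polynomial ℂ}
    (hq : ∃ j, (q j).coeff k ≠ 0) :
    Prime (coeffForm q (Sum.inl : _ → Fin (n + 1) ⊕ Fin (n + 1)) k) := by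
  classical
  obtain ⟨j, hj⟩ := hq
  let c : Fin (n + 1) ⊕ Fin (n + 1) →₀ ℂ :=
    Finsupp.equivFunOnFinite.symm (Sum.elim (fun j => (q j).coeff k) fun _ => 0)
  have hc : c (Sum.inl j) ≠ 0 := hj
  have : coeffForm q Sum.inl k = sumSMulX c := by
    simp [sumSMulX, Finsupp.linearCombination_apply, Finsupp.sum_fintype, coeffForm, c,
      smul_eq_C_mul, mul_comm]
  rw [this, ← UniqueFactorizationMonoid.irreducible_iff_prime]
  exact irreducible_sumSMulX c ⟨_, Finsupp.mem_support_iff.2 hc⟩ fun r hr =>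
    isUnit_of_dvd_unit (hr (Sum.inl j)) hc.isUnit

namespace IsParametrization

variable {n d : ℕ} {q : Fin (n + 1) → Polynomial ℂ} (h : IsParametrization d q)

include h

/-- Since $q_0=1$, the variable $\beta_0$ occurs only in the constant coefficient of the second
polynomial, as a bare summand. -/
theorem natDegree_and_coeff_univariateAt_bezoutForm : ∃ ε : ℤˣ,
    (univariateAt (Sum.inr 0) (bezoutForm d q)).natDegree ≤ d ∧
      (univariateAt (Sum.inr 0) (bezoutForm d q)).coeff d =
        ((ε : ℤ) : BiPoly n) * coeffForm q Sum.inl d ^ d := by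
  have e : univariateAt (Sum.inr 0) (bezoutForm d q) =
      (bezoutMatrix d (fun k => Polynomial.C (coeffForm q Sum.inl k)) fun k => if k = 0 then
        Polynomial.C (∑ j : Fin n, X (Sum.inr j.succ) * C ((q j.succ).coeff 0)) + Polynomial.X
        else Polynomial.C (coeffForm q Sum.inr k) :
          Matrix _ _ (Polynomial (BiPoly n))).det := by
    refine (map_det_bezoutMatrix (univariateAt (Sum.inr 0 : Fin (n + 1) ⊕ Fin (n + 1)) :
      BiPoly n →+* Polynomial (BiPoly n)) _ _ _).trans ?_
    congr 2 <;> ext1 k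
    · simp only [coeffForm, RingHom.coe_coe, map_sum]
      exact Finset.sum_congr rfl fun j _ => by
        rw [univariateAt_mul_C (by simp)]
    · rw [RingHom.coe_coe, coeffForm_eq_zero_add, map_add, map_sum,
        Finset.sum_congr rfl fun j _ => univariateAt_mul_C (by simp) _, ← map_sum]
      split_ifs with hk
      · subst hk
        simp [h.zero, univariateAt, add_comm]
      · have : (q 0).coeff k = 0 := by rw [h.zero, Polynomial.coeff_one, if_neg hk]
        simp [this]
  rw [e]
  exact natDegree_and_coeff_det_bezoutMatrix _ _ _ _

/-- Specialise to the pair $(1,q_j)$ with $q_j$ of degree `d`: there is no common zero, even at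
infinity, whereas the $t^d$ coefficient of $1$ is zero. -/
theorem coeffForm_not_dvd_bezoutForm :
    ¬ coeffForm q Sum.inl d ∣ bezoutForm d q := by
  rintro ⟨g, hg⟩
  obtain ⟨j, hj⟩ := h.exists_coeff_ne_zero
  have h1 : ∀ i, pencil q (Pi.single i 1) = q i := fun i => by
    rw [pencil, Finset.sum_eq_single i (by intro k _ hk; simp [hk]) (by simp)]
    simp
  have h2 := congrArg (eval (Sum.elim (Pi.single 0 1) (Pi.single j 1))) hg
  rw [map_mul, eval_coeffForm] at h2
  simp only [Sum.elim_inl, h1, h.zero, Polynomial.coeff_one, h.pos.ne', if_false, zero_mul] at h2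
  rw [h.eval_bezoutForm_eq_zero_iff, h1, h1, h.zero] at h2
  rcases h2 with ⟨-, h2⟩ | ⟨t, h2, -⟩
  · exact hj h2
  · simp at h2

/-- For generic `a`, the values of a generic combination at the zeros of `pencil q a` are
distinct. -/
theorem exists_separating_form (T : Finset ℂ) : ∃ (j : Fin (n + 1))
    (D : MvPolynomial (Fin (n + 1)) ℂ), j ≠ 0 ∧ D ≠ 0 ∧ ∀ b, eval b D ≠ 0 → b j ≠ 0 ∧
      Set.InjOn (fun t => (pencil q b).eval t) T := by
  obtain ⟨j, hj⟩ := h.exists_coeff_ne_zero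
  -- The factor `X j` with $j\ne0$ keeps `b` nonzero when its zeroth coordinate is changed later.
  refine ⟨j, X j * ∏ p ∈ T.offDiag, ∑ i, X i * C ((q i).eval p.1 - (q i).eval p.2), ?_, ?_, ?_⟩
  · rintro rfl
    rw [h.zero, Polynomial.coeff_one, if_neg h.pos.ne'] at hj
    exact hj rfl
  · refine mul_ne_zero (X_ne_zero j) (Finset.prod_ne_zero_iff.2 fun p hp h0 => ?_)
    refine (Finset.mem_offDiag.1 hp).2.2 (h.injective _ _ fun i => ?_)
    have := congrArg (eval (Pi.single i 1)) h0
    rw [map_sum, Finset.sum_eq_single i (by intro k _ hk; simp [hk]) (by simp)] at this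
    simpa [sub_eq_zero] using this
  · intro b hb
    rw [map_mul, eval_X, map_prod, mul_ne_zero_iff, Finset.prod_ne_zero_iff] at hb
    refine ⟨hb.1, fun s hs t ht hst => by_contra fun hne => ?_⟩
    refine hb.2 (s, t) (Finset.mem_offDiag.2 ⟨hs, ht, hne⟩) ?_
    simp only [eval_pencil] at hst
    simp [mul_sub, Finset.sum_sub_distrib, hst]

theorem bezoutForm_dvd {f : BiPoly n} (hf : ∀ (a b : Fin (n + 1) → ℂ), a ≠ 0 → b ≠ 0 →
    eval (Sum.elim a b) (bezoutForm d q) = 0 → eval (Sum.elim a b) f = 0) :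
    bezoutForm d q ∣ f := by
  obtain ⟨ε, hdeg, hcoeff⟩ := h.natDegree_and_coeff_univariateAt_bezoutForm
  obtain ⟨N, g, r, hdiv, hr⟩ := exists_pow_mul_eq_mul_add hdeg (univariateAt (Sum.inr 0) f)
  have hr0 : r = 0 := by
    obtain ⟨G, hG, hG'⟩ := h.exists_transversalForm
    refine Polynomial.ext fun k => eq_zero_of_generic_eval_eq_zero hG fun a ha => ?_
    obtain ⟨had, has⟩ := hG' a ha
    have hA0 : pencil q a ≠ 0 := fun h0 => had (by rw [h0, Polynomial.coeff_zero])
    have ha0 : a ≠ 0 := fun h0 => hA0 (by simp [h0, pencil])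
    obtain ⟨j, D, hj, hD, hDb⟩ := h.exists_separating_form (pencil q a).roots.toFinset
    refine ⟨D, hD, fun b hb => ?_⟩
    obtain ⟨hbj, hinj⟩ := hDb b hb
    have : r.map (eval (Sum.elim a b)) = 0 := by
      -- For each of the `d` roots $t$ of the first pencil, this node is the value of $\beta_0$ at
      -- which the second pencil also vanishes at $t$. A remainder of degree below `d` with `d`
      -- distinct zeros is zero.
      refine Polynomial.eq_zero_of_degree_lt_of_eval_index_eq_zero
        (v := fun t => b 0 - (pencil q b).eval t) (pencil q a).roots.toFinset
        (fun s hs t ht hst => hinj hs ht (sub_right_injective hst)) ?_ fun t ht => ?_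
      · rw [card_roots_toFinset (h.natDegree_pencil_le a) had has]
        exact Polynomial.degree_map_le.trans_lt hr
      · have hta : (pencil q a).eval t = 0 := by simpa [hA0] using ht
        set b' := Function.update b 0 (b 0 - (pencil q b).eval t) with hb'
        have htb : (pencil q b').eval t = 0 := by
          rw [hb', eval_pencil, Fin.sum_univ_succ, eval_pencil, Fin.sum_univ_succ]
          simp [h.zero]
        have hP := (h.eval_bezoutForm_eq_zero_iff a b').2 (Or.inr ⟨t, hta, htb⟩)
        have hf0 := hf a b' ha0 (fun h0 => hbj (by
          rw [← Function.update_of_ne hj (b 0 - (pencil q b).eval t) b, ← hb', h0]; rfl)) hP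
        have := congrArg (Polynomial.eval₂ (eval (Sum.elim a b)) (b 0 - (pencil q b).eval t)) hdiv
        rw [Polynomial.eval₂_add, Polynomial.eval₂_mul, Polynomial.eval₂_mul, eval₂_univariateAt,
          eval₂_univariateAt, Sum.update_elim_inr, ← hb', hP, hf0, mul_zero, zero_mul,
          zero_add] at this
        rw [Polynomial.eval_map, ← this]
    rw [← Polynomial.coeff_map, this, Polynomial.coeff_zero]
  have hmul := congrArg (Polynomial.eval (X (Sum.inr 0))) hdiv
  rw [hr0, add_zero, Polynomial.eval_mul, Polynomial.eval_mul, Polynomial.eval_pow,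
    Polynomial.eval_C, eval_univariateAt, eval_univariateAt, hcoeff, mul_pow, ← pow_mul] at hmul
  have hu : IsUnit ((((ε : ℤ) : BiPoly n)) ^ N) := by
    refine IsUnit.pow _ ?_
    exact (ε.isUnit.map (Int.castRingHom (BiPoly n)))
  have hp := prime_coeffForm (q := q) h.exists_coeff_ne_zero
  have hdvd : coeffForm q Sum.inl d ^ (d * N) ∣ g.eval (X (Sum.inr 0)) := by
    refine hp.pow_dvd_of_dvd_mul_left _ h.coeffForm_not_dvd_bezoutForm ⟨(ε : ℤ) ^ N * f, ?_⟩
    rw [← hmul]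
    ring
  obtain ⟨g', hg'⟩ := hdvd
  rw [hg'] at hmul
  have hmul' : ((ε : ℤ) : BiPoly n) ^ N * f = bezoutForm d q * g' :=
    mul_left_cancel₀ (pow_ne_zero (d * N) hp.ne_zero) (by linear_combination hmul)
  exact (hu.dvd_mul_left).1 ⟨g', hmul'⟩

theorem isDefiningPolynomial_bezoutForm :
    IsDefiningPolynomial (bezoutForm d q) (chowHypersurface h.curve) :=
  ⟨h.eval_bezoutForm_eq_zero_iff_mem, fun _ hf => h.bezoutForm_dvd fun a b ha hb h0 =>
    hf a b ha hb ((h.eval_bezoutForm_eq_zero_iff_mem a b ha hb).1 h0)⟩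

theorem bezoutForm_ne_zero : bezoutForm d q ≠ 0 := fun h0 =>
  h.coeffForm_not_dvd_bezoutForm (h0 ▸ dvd_zero _)

end IsParametrization

/-! ### Orbits of locally nilpotent derivations -/

section Taylor

variable {n : ℕ} (δ : PolyDerivation n) (x : Fin n → ℂ)

/-- The Taylor series at `x` of a polynomial along the flow of `δ`. -/
def flowSeries (f : MvPolynomial (Fin n) ℂ) : PowerSeries ℂ :=
  PowerSeries.mk fun j => eval x ((⇑δ)^[j] f) / (j.factorial : ℂ)

theorem succ_mul_coeff_flowSeries (k : ℕ) (f : MvPolynomial (Fin n) ℂ) :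
    ((k : ℂ) + 1) * PowerSeries.coeff (k + 1) (flowSeries δ x f) =
      PowerSeries.coeff k (flowSeries δ x (δ f)) := by
  have h1 : (k.factorial : ℂ) ≠ 0 := by exact_mod_cast k.factorial_ne_zero
  have h2 : (k : ℂ) + 1 ≠ 0 := by exact_mod_cast k.succ_ne_zero
  simp only [flowSeries, PowerSeries.coeff_mk, Nat.factorial_succ, Function.iterate_succ_apply]
  push_cast
  field_simp

theorem flowSeries_add (f g : MvPolynomial (Fin n) ℂ) :
    flowSeries δ x (f + g) = flowSeries δ x f + flowSeries δ x g := by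
  ext k
  simp [flowSeries, iterate_map_add, add_div]

theorem derivative_flowSeries (f : MvPolynomial (Fin n) ℂ) :
    PowerSeries.derivative ℂ (flowSeries δ x f) = flowSeries δ x (δ f) := by
  ext k
  rw [PowerSeries.coeff_derivative, ← succ_mul_coeff_flowSeries, mul_comm]

/-- This is the multiplicativity of $\exp(t\delta)$. Coefficient $k+1$ is determined by coefficient
$k$ of the derivative, and both sides obey the Leibniz rule. -/
theorem flowSeries_mul (f g : MvPolynomial (Fin n) ℂ) :
    flowSeries δ x (f * g) = flowSeries δ x f * flowSeries δ x g := by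
  suffices h : ∀ (k : ℕ) (f g : MvPolynomial (Fin n) ℂ),
      PowerSeries.coeff k (flowSeries δ x (f * g)) =
        PowerSeries.coeff k (flowSeries δ x f * flowSeries δ x g) from
    PowerSeries.ext fun k => h k f g
  intro k
  induction k with
  | zero => intro f g; simp [flowSeries, PowerSeries.coeff_mul]
  | succ k ih =>
    intro f g
    have hk : (k : ℂ) + 1 ≠ 0 := by exact_mod_cast k.succ_ne_zero
    refine mul_left_cancel₀ hk ?_
    rw [succ_mul_coeff_flowSeries, Derivation.leibniz, smul_eq_mul, smul_eq_mul, flowSeries_add,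
      map_add, ih, ih, mul_comm ((k : ℂ) + 1), ← PowerSeries.coeff_derivative, Derivation.leibniz,
      derivative_flowSeries, derivative_flowSeries, smul_eq_mul, smul_eq_mul, map_add]

theorem iterate_succ_C (k : ℕ) (c : ℂ) : (⇑δ)^[k + 1] (C c) = 0 := by
  rw [Function.iterate_succ_apply, derivation_C, iterate_map_zero]

theorem flowSeries_C (c : ℂ) : flowSeries δ x (C c) = PowerSeries.C c := by
  ext k
  rcases k with - | k
  · simp [flowSeries]
  · rw [flowSeries, PowerSeries.coeff_mk, iterate_succ_C]
    simp

/-- The Taylor series along the flow as a ring homomorphism. -/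
def flowHom : MvPolynomial (Fin n) ℂ →+* PowerSeries ℂ where
  toFun := flowSeries δ x
  map_one' := by rw [← C_1, flowSeries_C, map_one]
  map_mul' := flowSeries_mul δ x
  map_zero' := by rw [← C_0, flowSeries_C, map_zero]
  map_add' := flowSeries_add δ x

end Taylor

section Orbit

variable {n d : ℕ} (δ : PolyDerivation n) (x : Fin n → ℂ)

/-- The homogeneous coordinates of the orbit through `x`, as polynomials in the parameter. -/
def orbitCoord (d : ℕ) (j : Fin (n + 1)) : Polynomial ℂ :=
  ∑ k ∈ Finset.range (d + 1),
    Polynomial.monomial k (eval x ((⇑δ)^[k] (coord n j)) / (k.factorial : ℂ))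

theorem coeff_orbitCoord (d : ℕ) (j : Fin (n + 1)) (k : ℕ) :
    (orbitCoord δ x d j).coeff k =
      if k ≤ d then eval x ((⇑δ)^[k] (coord n j)) / (k.factorial : ℂ) else 0 := by
  simp [orbitCoord, Polynomial.finsetSum_coeff, Polynomial.coeff_monomial]

theorem orbitCoord_zero (d : ℕ) : orbitCoord δ x d 0 = 1 := by
  ext k
  rw [coeff_orbitCoord, Polynomial.coeff_one]
  rcases k with - | k
  · simp [coord]
  · have : coord n 0 = C 1 := by simp [coord]
    rw [this, iterate_succ_C]
    simp

variable {δ} (hdeg : HasDegree δ d)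

include hdeg

theorem HasDegree.iterate_eq_zero {k : ℕ} (hk : d < k) (j : Fin n) : (⇑δ)^[k] (X j) = 0 := by
  obtain ⟨e, rfl⟩ := Nat.exists_eq_add_of_le hk
  rw [add_comm, Function.iterate_add_apply, Nat.succ_eq_add_one, hdeg.1 j, iterate_map_zero]

theorem flowSeries_eq_aeval_orbitCoord (f : MvPolynomial (Fin n) ℂ) :
    flowSeries δ x f = (aeval (fun j : Fin n => orbitCoord δ x d j.succ) f : Polynomial ℂ) := by
  have : flowHom δ x = Polynomial.coeToPowerSeries.ringHom.comp
      (aeval fun j : Fin n => orbitCoord δ x d j.succ : _ →ₐ[ℂ] Polynomial ℂ).toRingHom := by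
    refine MvPolynomial.ringHom_ext (fun c => ?_) fun j => ?_
    · exact (flowSeries_C δ x c).trans (by simp)
    · refine PowerSeries.ext fun k => ?_
      simp only [RingHom.comp_apply, AlgHom.toRingHom_eq_coe, RingHom.coe_coe, aeval_X,
        Polynomial.coeToPowerSeries.ringHom_apply, Polynomial.coeff_coe, coeff_orbitCoord]
      rw [show flowHom δ x (X j) = flowSeries δ x (X j) from rfl, flowSeries, PowerSeries.coeff_mk]
      split_ifs with hk
      · simp [coord]
      · rw [hdeg.iterate_eq_zero (not_le.1 hk)]
        simp
  exact congrArg (fun φ => φ f) this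

/-- The orbit is an integral curve of $\delta$. -/
theorem derivative_aeval_orbitCoord (f : MvPolynomial (Fin n) ℂ) :
    Polynomial.derivative (aeval (fun j : Fin n => orbitCoord δ x d j.succ) f) =
      aeval (fun j : Fin n => orbitCoord δ x d j.succ) (δ f) := by
  apply Polynomial.coe_injective ℂ
  rw [← flowSeries_eq_aeval_orbitCoord x hdeg, ← derivative_flowSeries,
    flowSeries_eq_aeval_orbitCoord x hdeg, PowerSeries.derivative_coe]

theorem actPoint_eq_sum (t : ℂ) (y : Fin n → ℂ) (j : Fin n) : actPoint δ t y j =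
    ∑ k ∈ Finset.range (d + 1), (-t) ^ k / (k.factorial : ℂ) * eval y ((⇑δ)^[k] (X j)) := by
  rw [actPoint, actFun, finsum_eq_sum_of_support_subset (s := Finset.range (d + 1))]
  · simp [map_sum, smul_eval]
  · intro k hk
    by_contra hk'
    refine hk ?_
    simp only [Finset.coe_range, Set.mem_Iio, not_lt] at hk'
    simp only [hdeg.iterate_eq_zero (show d < k by omega), smul_zero]

theorem eval_orbitCoord_succ (t : ℂ) (j : Fin n) :
    (orbitCoord δ x d j.succ).eval t = actPoint δ (-t) x j := by
  rw [actPoint_eq_sum hdeg, orbitCoord, Polynomial.eval_finsetSum]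
  refine Finset.sum_congr rfl fun k _ => ?_
  simp only [Polynomial.eval_monomial, coord, Fin.cons_succ, neg_neg]
  ring

/-- The parametrisation of an orbit satisfies the group law. -/
theorem actPoint_orbitCoord (s t : ℂ) (j : Fin n) :
    actPoint δ (-t) (fun i => (orbitCoord δ x d i.succ).eval s) j =
      (orbitCoord δ x d j.succ).eval (t + s) := by
  -- Successive derivatives along the orbit are the values of $\delta^kx_j$, so the sum defining the
  -- action is the Taylor expansion at $s$.
  have hder : ∀ k, Polynomial.derivative^[k] (orbitCoord δ x d j.succ) =
      aeval (fun i : Fin n => orbitCoord δ x d i.succ) ((⇑δ)^[k] (X j)) := by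
    intro k
    induction k with
    | zero => simp
    | succ k ih =>
      rw [Function.iterate_succ_apply', ih, derivative_aeval_orbitCoord x hdeg,
        Function.iterate_succ_apply']
  have hnat : (Polynomial.taylor s (orbitCoord δ x d j.succ)).natDegree < d + 1 := by
    rw [Polynomial.natDegree_taylor, Nat.lt_succ_iff, Polynomial.natDegree_le_iff_coeff_eq_zero]
    intro N hN
    rw [coeff_orbitCoord, if_neg (by omega)]
  rw [actPoint_eq_sum hdeg, ← Polynomial.taylor_eval, Polynomial.eval_eq_sum_range' hnat]
  refine Finset.sum_congr rfl fun k _ => ?_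
  have hk : (k.factorial : ℂ) ≠ 0 := by exact_mod_cast k.factorial_ne_zero
  have h1 : (k.factorial : ℂ) * (Polynomial.hasseDeriv k (orbitCoord δ x d j.succ)).eval s =
      eval (fun i => (orbitCoord δ x d i.succ).eval s) ((⇑δ)^[k] (X j)) := by
    rw [← eval_aeval_polynomial, ← hder, ← Polynomial.factorial_smul_hasseDeriv,
      LinearMap.smul_apply, Polynomial.eval_smul, nsmul_eq_mul]
  rw [← h1, Polynomial.taylor_coeff, neg_neg]
  field_simp

/-- Freeness enters twice: $d=0$ would make the action trivial, and equal points at $s$ and $t$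
would be fixed by the time $-(t-s)$. -/
theorem isParametrization_orbitCoord (hfree : IsFreeAction δ) (hx : x ∈ genericSet δ d) :
    IsParametrization d (orbitCoord δ x d) where
  pos := by
    rcases Nat.eq_zero_or_pos d with rfl | hd
    · refine absurd (hfree 1 x (funext fun j => ?_)) one_ne_zero
      simp [actPoint_eq_sum hdeg]
    · exact hd
  zero := orbitCoord_zero δ x d
  natDegree_le j := by
    rw [Polynomial.natDegree_le_iff_coeff_eq_zero]
    intro N hN
    rw [coeff_orbitCoord, if_neg (by omega)]
  exists_coeff_ne_zero := by
    obtain ⟨j, hj⟩ := hx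
    refine ⟨j.succ, ?_⟩
    rw [coeff_orbitCoord, if_pos le_rfl]
    exact div_ne_zero (by simpa [coord] using hj) (by exact_mod_cast d.factorial_ne_zero)
  injective s t hst := by
    have h := hfree (-(t - s)) (fun i => (orbitCoord δ x d i.succ).eval s) (funext fun j => by
      rw [actPoint_orbitCoord x hdeg, sub_add_cancel, hst])
    linear_combination h

theorem orbitClosure_eq_curve (h : IsParametrization d (orbitCoord δ x d)) :
    orbitClosure δ x = h.curve := by
  rw [orbitClosure, IsParametrization.curve]
  congr 1
  have : ∀ t, embed (actPoint δ t x) = h.point (-t) := fun t => by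
    rw [embed, IsParametrization.point]
    congr 1
    refine funext fun j => Fin.cases ?_ (fun j => ?_) j
    · simp [orbitCoord_zero]
    · rw [eval_orbitCoord_succ x hdeg, neg_neg, Fin.cons_succ]
  simp only [this]
  exact neg_surjective.range_comp h.point

end Orbit

/-! ### The explicit polynomial -/

theorem prod_range_sub_mul_factorial {R : Type*} [CommRing R] {d m : ℕ} (hm : m ≤ d) :
    (∏ j ∈ Finset.range m, ((d : R) - j)) * ((d - m).factorial : R) = (d.factorial : R) := by
  induction m with
  | zero => simp
  | succ m ih =>
    rw [← ih (by omega), Finset.prod_range_succ, show d - m = d - (m + 1) + 1 by omega,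
      Nat.factorial_succ]
    have : ((d - (m + 1) + 1 : ℕ) : R) = d - m := by
      rw [show d - (m + 1) + 1 = d - m by omega, Nat.cast_sub (by omega)]
    rw [Nat.cast_mul, this]
    ring

theorem eq_factorial_mul_coeffForm {n d : ℕ} (δ : PolyDerivation n) (x : Fin n → ℂ)
    (i : Fin (n + 1) → Fin (n + 1) ⊕ Fin (n + 1)) {k : ℕ} (hk : k ≤ d) :
    (∑ j, X (i j) * C (eval x ((⇑δ)^[k] (coord n j))) : BiPoly n) =
      (k.factorial : BiPoly n) * coeffForm (orbitCoord δ x d) i k := by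
  have h1 : (k.factorial : ℂ) ≠ 0 := by exact_mod_cast k.factorial_ne_zero
  rw [coeffForm, Finset.mul_sum]
  refine Finset.sum_congr rfl fun j _ => ?_
  rw [coeff_orbitCoord, if_pos hk, mul_left_comm, ← map_natCast C, ← map_mul, mul_div_cancel₀ _ h1]

/-- Passing to Taylor coefficients multiplies the term with index $r$ by $(l+1+r)!\,(k-r)!$. The two
products are $d!/(l+1+r)!$ and $k!/(k-r)!$, so the total factor $d!\,k!$ does not depend on $r$. -/
theorem formF_eq_factorial_mul_bezoutMatrix {n d : ℕ} (δ : PolyDerivation n) (x : Fin n → ℂ)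
    (l k : Fin d) : formF δ d x ((l : ℕ) + 1) k =
      ((d.factorial : BiPoly n) * ((k : ℕ).factorial : BiPoly n)) *
        bezoutMatrix d (coeffForm (orbitCoord δ x d) Sum.inl)
          (coeffForm (orbitCoord δ x d) Sum.inr) l k := by
  rw [formF, bezoutMatrix, Matrix.of_apply, Finset.mul_sum]
  refine Finset.sum_congr rfl fun r hr => ?_
  rw [Finset.mem_range] at hr
  have h1 := prod_range_sub_mul_factorial (R := BiPoly n) (d := d) (m := d - (l + 1) - r) (by omega)
  have h2 := prod_range_sub_mul_factorial (R := BiPoly n) (d := k) (m := r) (by omega)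
  rw [show d - (d - ((l : ℕ) + 1) - r) = l + 1 + r by omega] at h1
  rw [← h1, ← h2]
  simp only [formf, formA, formB]
  rw [eq_factorial_mul_coeffForm δ x Sum.inl (d := d) (k := l + 1 + r) (by omega),
    eq_factorial_mul_coeffForm δ x Sum.inl (d := d) (k := k - r) (by omega),
    eq_factorial_mul_coeffForm δ x Sum.inr (d := d) (k := l + 1 + r) (by omega),
    eq_factorial_mul_coeffForm δ x Sum.inr (d := d) (k := k - r) (by omega)]
  ring

theorem chowPoly_eq_smul_bezoutForm {n : ℕ} (δ : PolyDerivation n) (d : ℕ) (x : Fin n → ℂ) :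
    ∃ c : ℂ, c ≠ 0 ∧ chowPoly δ d x = c • bezoutForm d (orbitCoord δ x d) := by
  refine ⟨∏ k : Fin d, ((d.factorial : ℂ) * ((k : ℕ).factorial : ℂ)),
    Finset.prod_ne_zero_iff.2 fun k _ => by
      exact_mod_cast mul_ne_zero d.factorial_ne_zero (k : ℕ).factorial_ne_zero, ?_⟩
  rw [chowPoly, bezoutForm, smul_eq_C_mul, map_prod]
  simp only [formF_eq_factorial_mul_bezoutMatrix, Matrix.det_mul_row, map_mul, map_natCast]

theorem IsDefiningPolynomial.smul {n : ℕ} {P : BiPoly n} {H : Set (ProjSpace n × ProjSpace n)}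
    (h : IsDefiningPolynomial P H) {c : ℂ} (hc : c ≠ 0) : IsDefiningPolynomial (c • P) H := by
  refine ⟨fun a b ha hb => ?_, fun f hf => ?_⟩
  · rw [smul_eval, mul_eq_zero, or_iff_right hc, h.1 a b ha hb]
  · rw [smul_eq_C_mul]
    exact ((hc.isUnit.map C).mul_left_dvd).2 (h.2 f hf)

end

end ChowOrbit

theorem mainTheorem1 (n d : ℕ) (δ : ChowOrbit.PolyDerivation n)
    (hnil : ChowOrbit.IsLocallyNilpotent δ) (hfree : ChowOrbit.IsFreeAction δ)
    (hdeg : ChowOrbit.HasDegree δ d) (x : Fin n → ℂ) (hx : x ∈ ChowOrbit.genericSet δ d) :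
    ∃ (hP : ChowOrbit.chowPoly δ d x ∈ ChowOrbit.bihomForms n d)
      (h0 : (⟨ChowOrbit.chowPoly δ d x, hP⟩ : ChowOrbit.bihomForms n d) ≠ 0),
      ChowOrbit.IsChowPoint (ChowOrbit.orbitClosure δ x)
        (Projectivization.mk ℂ
          (⟨ChowOrbit.chowPoly δ d x, hP⟩ : ChowOrbit.bihomForms n d) h0) := by
  have h := ChowOrbit.isParametrization_orbitCoord x hdeg hfree hx
  obtain ⟨c, hc, hPc⟩ := ChowOrbit.chowPoly_eq_smul_bezoutForm δ d x
  have hP : ChowOrbit.chowPoly δ d x ∈ ChowOrbit.bihomForms n d :=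
    hPc ▸ Submodule.smul_mem _ c (ChowOrbit.bezoutForm_mem_bihomForms d _)
  have h0 : (⟨ChowOrbit.chowPoly δ d x, hP⟩ : ChowOrbit.bihomForms n d) ≠ 0 := fun h0 =>
    smul_ne_zero hc h.bezoutForm_ne_zero (hPc ▸ congrArg Subtype.val h0)
  refine ⟨hP, h0, ?_⟩
  rw [ChowOrbit.orbitClosure_eq_curve x hdeg h]
  refine ⟨h.isCurveOfDegree_curve, ?_⟩
  -- The chosen representative of the class is only a unit multiple of `P(x)`, which does not affect
  -- being a defining polynomial.
  obtain ⟨u, hu⟩ := Projectivization.exists_smul_eq_mk_rep ℂ _ h0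
  rw [← hu, Units.smul_def, Submodule.coe_smul]
  refine ChowOrbit.IsDefiningPolynomial.smul ?_ u.ne_zero
  rw [show ((⟨ChowOrbit.chowPoly δ d x, hP⟩ : ChowOrbit.bihomForms n d) : ChowOrbit.BiPoly n) =
    c • ChowOrbit.bezoutForm d (ChowOrbit.orbitCoord δ x d) from hPc]
  exact h.isDefiningPolynomial_bezoutForm.smul hc
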